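/- **Theorem (dual conditional maximum entropy ICE problem).** *Setting.* Let $V$ be a real Hilbert space, $\mathcal K\subseteq V$ any set, $\mathcal K^*=\{x\in V:\langle x,y\rangle\ge 0\ \forall y\in\mathcal K\}$ and $\mathcal K^{**}=(\mathcal K^*)^*$. Let $\mathcal G$ be a (measurable) class of vector-valued normal-form games; each $\Gamma\in\mathcal G$ has finitely many players, finite action sets $A_i^\Gamma$, outcome set $\mathcal A^\Gamma=\prod_i A_i^\Gamma$ and utility features $u_i^\Gamma:\mathcal A^\Gamma\to V$. Players and action sets may differ from game to game. Let $\xi$ be a probability distribution on $\mathcal G$. A deviation $f$ has instantaneous regret features $r^\Gamma_f:\mathcal A^\Gamma\to V$ in each game (for a unilateral deviation $f_i$ of player $i$, $r^\Gamma_{f}(a)=u_i^\Gamma(f_i(a))-u_i^\Gamma(a)$), and $r^\Gamma_f(a|w)=\langle r^\Gamma_f(a),w\rangle$. A strategy family $\sigma=(\sigma^\Gamma)_{\Gamma\in\mathcal G}$ consists of distributions $\sigma^\Gamma\in\Delta_{\mathcal A^\Gamma}$, depending measurably on $\Gamma$. Put $$r^\xi_f(\sigma)=\mathbb E_{\Gamma\sim\xi}\Big[\sum_{a}\sigma^\Gamma(a)\,r^\Gamma_f(a)\Big],\qquad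 r^\xi_f(\sigma|w)=\mathbb E_{\Gamma\sim\xi}\Big[\sum_{a}\sigma^\Gamma(a)\,r^\Gamma_f(a|w)\Big],\qquad \operatorname{Regret}^\xi_{\Psi}(\sigma|w)=\max_{f\in\Psi}r^\xi_f(\sigma|w),$$ $$H^\xi(\sigma)=\mathbb E_{\Gamma\sim\xi}\Big[-\sum_{a}\sigma^\Gamma(a)\log\sigma^\Gamma(a)\Big].$$ Let $\Phi$ be a finite set of deviations and, for each $f\in\Phi$, let $\Phi_f$ be a finite nonempty set of deviations. Assume that $\log|\mathcal A^\Gamma|$ and, for each deviation $f$, $\max_a\|r^\Gamma_f(a)\|$ are $\xi$-integrable functions of $\Gamma$ (both hold automatically if $\mathcal G$ is finite). Let $\sigma$ be a strategy family (the true behavior). *Primal.* The conditional maximum entropy ICE program is: over strategy families $\hat\sigma$ and distributions $\eta_f\in\Delta_{\Phi_f}$ $(f\in\Phi)$, $$\text{maximize } H^\xi(\hat\sigma)\quad\text{subject to}\quad r^\xi_f(\hat\sigma)-\mathbb E_{g\sim\eta_f}\big[r^\xi_g(\sigma)\big]\in-\mathcal K^*\quad\forall f\in\Phi .$$ Its Lagrange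 dual, with a multiplier $\theta_f$ for the constraint of $f$ ranging over the dual cone of $\mathcal K^*$, is to minimize over those $\theta=(\theta_f)_{f\in\Phi}$ the dual function $q(\theta)=\sup_{\hat\sigma,\eta}\big\{H^\xi(\hat\sigma)-\sum_{f\in\Phi}\langle r^\xi_f(\hat\sigma)-\mathbb E_{g\sim\eta_f}[r^\xi_g(\sigma)],\theta_f\rangle\big\}$, the supremum being over all strategy families $\hat\sigma$ and all $\eta_f\in\Delta_{\Phi_f}$. *Claim.* All the expectations above and below exist and are finite, and: 1. The dual problem is the convex program $$\operatorname*{minimize}_{\theta_f\in\mathcal K^{**},\,f\in\Phi}\ \ D(\theta)=\sum_{f\in\Phi}\operatorname{Regret}^\xi_{\Phi_f}(\sigma|\theta_f)+\mathbb E_{\Gamma\sim\xi}\big[\log Z^\Gamma(\theta)\big],\qquad Z^\Gamma(\theta)=\sum_{a\in\mathcal A^\Gamma}\exp\Big(-\sum_{f\in\Phi}r^\Gamma_f(a|\theta_f)\Big);$$ indeed $q(\theta)=D(\theta)$ for every $\theta\in V^\Phi$. 2. Strong duality holds: the supremum of the primal equals the infimum of the dual (both are $-\infty$ if the primal is infeasible).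 3. If $\theta^*$ is a solution of the dual problem, then the strategy family $$\hat\sigma^\Gamma(a)=\frac{1}{Z^\Gamma(\theta^*)}\exp\Big(-\sum_{f\in\Phi}r^\Gamma_f(a|\theta^*_f)\Big)\qquad(\Gamma\in\mathcal G,\ a\in\mathcal A^\Gamma)$$ together with some $\eta$ solves the primal program, and every primal solution has this strategy family for $\xi$-almost every $\Gamma$. -/

import Mathlib

open MeasureTheory
open scoped InnerProductSpace

noncomputable section

/-! ### Concave programs with conic constraints and their Lagrange duals -/

/-- The program: maximize `objective x` over `x : X` subject to
`constraint i x ∈ -(cone i)` for every `i`. -/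
structure ConicProgram (X ι W : Type*) [NormedAddCommGroup W] [InnerProductSpace ℝ W] where
  objective : X → ℝ
  constraint : ι → X → W
  cone : ι → ProperCone ℝ W

namespace ConicProgram

variable {X ι W : Type*} [NormedAddCommGroup W] [InnerProductSpace ℝ W]

/-- Primal feasibility: each `constraint i x` lies in `-(cone i)`. -/
def Feasible (P : ConicProgram X ι W) (x : X) : Prop :=
  ∀ i, -P.constraint i x ∈ P.cone i

/-- `x` solves the program. -/
def IsOptimal (P : ConicProgram X ι W) (x : X) : Prop :=
  P.Feasible x ∧ ∀ y, P.Feasible y → P.objective y ≤ P.objective x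

/-- The optimal value (`⊥` if the program is infeasible). -/
def value (P : ConicProgram X ι W) : EReal :=
  ⨆ (x : X) (_ : P.Feasible x), (P.objective x : EReal)

/-- The Lagrangian, with a multiplier `θ i` for the `i`-th conic constraint. -/
def lagrangian [Fintype ι] (P : ConicProgram X ι W) (x : X) (θ : ι → W) : ℝ :=
  P.objective x - ∑ i, ⟪P.constraint i x, θ i⟫_ℝ

/-- The multipliers range over the dual cones of the constraint cones. -/
def DualFeasible [CompleteSpace W] (P : ConicProgram X ι W) (θ : ι → W) : Prop :=
  ∀ i, θ i ∈ ProperCone.innerDual (P.cone i : Set W)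

/-- The Lagrange dual function: the supremum of the Lagrangian over all `x : X`. -/
def dualObjective [Fintype ι] (P : ConicProgram X ι W) (θ : ι → W) : EReal :=
  ⨆ x : X, (P.lagrangian x θ : EReal)

/-- The optimal value of the dual problem: minimize `dualObjective θ` over feasible multipliers. -/
def dualValue [Fintype ι] [CompleteSpace W] (P : ConicProgram X ι W) : EReal :=
  ⨅ (θ : ι → W) (_ : P.DualFeasible θ), P.dualObjective θ

end ConicProgram

/-! ### Vector-valued games and classes of games -/

/-- A vector-valued normal-form game: finitely many players, a finite action set for each of them,
and utility features in `V` for each player and each joint action. -/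
structure VectorGame.{u, v} (V : Type v) where
  Player : Type u
  Action : Player → Type u
  [fintypePlayer : Fintype Player]
  [decEqPlayer : DecidableEq Player]
  [fintypeAction : ∀ i, Fintype (Action i)]
  utility : Player → (∀ i, Action i) → V

attribute [instance] VectorGame.fintypePlayer VectorGame.decEqPlayer VectorGame.fintypeAction

namespace VectorGame

universe u v

/-- The outcomes (joint actions) of a game. -/
abbrev Outcome {V : Type v} (G : VectorGame.{u, v} V) : Type u := ∀ i, G.Action i

/-- Shannon entropy of a joint strategy. -/
def entropy {V : Type v} (G : VectorGame.{u, v} V) (s : stdSimplex ℝ G.Outcome) : ℝ :=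
  ∑ a, -(s.1 a * Real.log (s.1 a))

/-- Instantaneous regret features of the deviation that replaces the action `a i` of player `i`
by `φ (a i)`. -/
def unilateralRegret {V : Type v} [AddCommGroup V] (G : VectorGame.{u, v} V) (i : G.Player)
    (φ : G.Action i → G.Action i) (a : G.Outcome) : V :=
  G.utility i (Function.update a i (φ (a i))) - G.utility i a

end VectorGame

/-- A class of games indexed by a measurable space `𝒢`. Different games may have different players
and actions. To make sense of measurable dependence on the game, the finitely many outcomes of
each game carry distinct labels in `ℕ`, and the set of games that have an outcome with a given label
is measurable. (For a finite or countable discrete class every labelling will do.) -/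
structure GameClass.{u, v, w} (𝒢 : Type w) [MeasurableSpace 𝒢] (V : Type v) where
  game : 𝒢 → VectorGame.{u, v} V
  label : ∀ Γ, (game Γ).Outcome → ℕ
  label_injective : ∀ Γ, Function.Injective (label Γ)
  measurableSet_label : ∀ l, MeasurableSet {Γ | ∃ a, label Γ a = l}

namespace GameClass

universe u v w

variable {𝒢 : Type w} [MeasurableSpace 𝒢] {V : Type v}

/-- The outcomes of the game `Γ`. -/
abbrev Outcome (C : GameClass.{u} 𝒢 V) (Γ : 𝒢) : Type u := (C.game Γ).Outcome

/-- A quantity `h Γ a`, given for each game `Γ` and each outcome `a` of `Γ`, depends measurably on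
the game: for each label `l`, its value at the outcome labelled `l` (and `0` where there is no
such outcome) is a measurable function of the game. -/
def MeasurableFamily (C : GameClass.{u} 𝒢 V) {E : Type*} [TopologicalSpace E] [Zero E]
    (h : ∀ Γ, C.Outcome Γ → E) : Prop :=
  ∀ l, StronglyMeasurable fun Γ => Function.extend (C.label Γ) (h Γ) (fun _ => (0 : E)) l

/-- A set of strategies: for each game of the class a joint strategy (a distribution over its
outcomes), depending measurably on the game. -/
structure Strategy (C : GameClass.{u} 𝒢 V) where
  prob : ∀ Γ, stdSimplex ℝ (C.Outcome Γ)
  measurable : C.MeasurableFamily fun Γ a => (prob Γ).1 a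

variable [NormedAddCommGroup V] [InnerProductSpace ℝ V]

/-- A deviation for the class: its instantaneous regret features `r^Γ_f(a)` in each game. These are
arbitrary (measurable); `Deviation.unilateral` gives the deviations of a player from its action. -/
structure Deviation (C : GameClass.{u} 𝒢 V) where
  regret : ∀ Γ, C.Outcome Γ → V
  measurable : C.MeasurableFamily regret

/-- The deviation in which, in each game `Γ`, player `i Γ` modifies its action by `φ Γ`. -/
def Deviation.unilateral (C : GameClass.{u} 𝒢 V) (i : ∀ Γ, (C.game Γ).Player)
    (φ : ∀ Γ, (C.game Γ).Action (i Γ) → (C.game Γ).Action (i Γ))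
    (h : C.MeasurableFamily fun Γ a => (C.game Γ).unilateralRegret (i Γ) (φ Γ) a) : C.Deviation :=
  ⟨fun Γ a => (C.game Γ).unilateralRegret (i Γ) (φ Γ) a, h⟩

variable {C : GameClass.{u} 𝒢 V}

/-- Expected regret features in the game `Γ`. -/
def gameRegretFeatures (f : C.Deviation) (s : C.Strategy) (Γ : 𝒢) : V :=
  ∑ a, (s.prob Γ).1 a • f.regret Γ a

/-- Expected regret features when games are distributed according to `ξ`. -/
def regretFeatures (ξ : Measure 𝒢) (f : C.Deviation) (s : C.Strategy) : V :=
  ∫ Γ, gameRegretFeatures f s Γ ∂ξ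

/-- Expected regret under the utility function `w` when games are distributed according to `ξ`. -/
def expectedRegret (ξ : Measure 𝒢) (f : C.Deviation) (s : C.Strategy) (w : V) : ℝ :=
  ∫ Γ, ∑ a, (s.prob Γ).1 a * ⟪f.regret Γ a, w⟫_ℝ ∂ξ

/-- The regret of `s` under `w` with respect to a finite nonempty set `Ψ` of deviations: the
maximum of the expected regrets. -/
def maxRegret (ξ : Measure 𝒢) {D : Type*} (dev : D → C.Deviation) (Ψ : Finset D)
    (hΨ : Ψ.Nonempty) (s : C.Strategy) (w : V) : ℝ :=
  Ψ.sup' hΨ fun g => expectedRegret ξ (dev g) s w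

/-- Conditional Shannon entropy when games are distributed according to `ξ`. -/
def condEntropy (ξ : Measure 𝒢) (s : C.Strategy) : ℝ :=
  ∫ Γ, (C.game Γ).entropy (s.prob Γ) ∂ξ

/-- The exponential-family weight `exp (-∑ f ∈ Φ, r_f(a | θ_f))` of an outcome `a` of `Γ`. -/
def expWeight {D : Type*} (dev : D → C.Deviation) (Φ : Finset D) (θ : Φ → V)
    (Γ : 𝒢) (a : C.Outcome Γ) : ℝ :=
  Real.exp (-∑ f : Φ, ⟪(dev f).regret Γ a, θ f⟫_ℝ)

/-- The partition function of the game `Γ`. -/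
def partitionFunction {D : Type*} (dev : D → C.Deviation) (Φ : Finset D) (θ : Φ → V)
    (Γ : 𝒢) : ℝ :=
  ∑ a, expWeight dev Φ θ Γ a

/-- The primal conditional maximum entropy ICE program. The variables are the predicted
strategies `x.1` and, for each `f ∈ Φ`, a distribution `x.2 f` over the comparison set `Φ_f`; the
constraints are those of the conditional `K`-ICE polytope for the true behavior `σ`. -/
def iceProgram [CompleteSpace V] (ξ : Measure 𝒢) {D : Type*} (dev : D → C.Deviation) (Φ : Finset D)
    (Φc : Φ → Finset D) (K : Set V) (σ : C.Strategy) :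
    ConicProgram (C.Strategy × (∀ f : Φ, stdSimplex ℝ (Φc f))) Φ V where
  objective x := condEntropy ξ x.1
  constraint f x := regretFeatures ξ (dev f) x.1 -
    ∑ g : Φc f, (x.2 f).1 g • regretFeatures ξ (dev g) σ
  cone _ := ProperCone.innerDual K

/-- The claimed dual objective
`∑ f ∈ Φ, Regret_{Φ_f}(σ | θ_f) + E_{Γ ∼ ξ} [log Z^Γ(θ)]`. -/
def iceDualObjective (ξ : Measure 𝒢) {D : Type*} (dev : D → C.Deviation) (Φ : Finset D)
    (Φc : Φ → Finset D) (hΦc : ∀ f, (Φc f).Nonempty) (σ : C.Strategy) (θ : Φ → V) : ℝ :=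
  ∑ f : Φ, maxRegret ξ dev (Φc f) (hΦc f) σ (θ f) +
    ∫ Γ, Real.log (partitionFunction dev Φ θ Γ) ∂ξ

/-- The bidual cone `K** = (K*)*`. -/
def bidualCone [CompleteSpace V] (K : Set V) : ProperCone ℝ V :=
  ProperCone.innerDual (ProperCone.innerDual K : Set V)

end GameClass

end

noncomputable section

/-! ### Shannon entropy on a finite simplex -/

/-! For fixed multipliers the Lagrangian decouples: it is the expectation over games of entropy
minus a linear function of the predicted strategy, plus a term linear in `η`. In each game the Gibbs
variational principle bounds the first part by `log Z`, with gap the Kullback–Leibler divergence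
from the Gibbs distribution (`entropy_gap_eq`); the `η` part is maximal at a vertex of each simplex.
Hence the dual function is the claimed objective (`dualObjective_eq`), its supremum is attained, and
it is convex as a maximum of affine functions.

Strong duality must do without a Slater condition and without dual attainment. Hahn–Banach then
yields only asymptotically feasible points whose entropy approaches a finite dual infimum `v`
(`exists_asymptotically_feasible`). Strong concavity of entropy replaces compactness of the strategy
space: midpoints of far-apart strategies would gain entropy, while a nearly optimal multiplier keeps
the entropy of almost feasible points near `v`. So the strategies are Cauchy in mean square; a
subsequence converges almost everywhere, the `η` converge by compactness, and dominated convergence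
produces a feasible point of value at least `v` (`exists_feasible_of_dual_infimum`).

At an optimal multiplier such a point leaves no gap in the Gibbs inequality, so it is the Gibbs
strategy almost everywhere. -/

lemma entropy_gap_eq {α : Type*} [Fintype α] [Nonempty α] (e : α → ℝ) {p : α → ℝ}
    (hp : p ∈ stdSimplex ℝ α) :
    Real.log (∑ a, Real.exp (e a)) - (∑ a, -(p a * Real.log (p a)) + ∑ a, p a * e a) =
      ∑ a, Real.exp (e a) / (∑ b, Real.exp (e b)) *
        InformationTheory.klFun (p a / (Real.exp (e a) / ∑ b, Real.exp (e b))) := by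
  set Z := ∑ b, Real.exp (e b) with hZ
  have hZ0 : 0 < Z := Finset.sum_pos (fun a _ => Real.exp_pos _) Finset.univ_nonempty
  -- The form `q * klFun (p / q) = p log (p / q) + q - p` is nonnegative termwise, unlike `p log (p
  -- / q)`, so the equality case can be read off outcome by outcome.
  have key : ∀ a, Real.exp (e a) / Z * InformationTheory.klFun (p a / (Real.exp (e a) / Z)) =
      p a * Real.log (p a) - p a * e a + p a * Real.log Z + Real.exp (e a) / Z - p a := by
    intro a
    have hq : 0 < Real.exp (e a) / Z := div_pos (Real.exp_pos _) hZ0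
    have hlog : p a * Real.log (p a / (Real.exp (e a) / Z)) =
        p a * (Real.log (p a) - (e a - Real.log Z)) := by
      rcases eq_or_ne (p a) 0 with h | h
      · simp [h]
      · rw [Real.log_div h hq.ne', Real.log_div (Real.exp_pos _).ne' hZ0.ne', Real.log_exp]
    rw [InformationTheory.klFun]
    have : Real.exp (e a) / Z * (p a / (Real.exp (e a) / Z) *
        Real.log (p a / (Real.exp (e a) / Z)) + 1 - p a / (Real.exp (e a) / Z)) =
        p a * Real.log (p a / (Real.exp (e a) / Z)) + Real.exp (e a) / Z - p a := by
      field_simp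
    rw [this, hlog]; ring
  simp only [key, Finset.sum_sub_distrib, Finset.sum_add_distrib, Finset.sum_neg_distrib,
    ← Finset.sum_mul, ← Finset.sum_div, hp.2, ← hZ, div_self hZ0.ne']
  ring

lemma entropy_add_le_log_sum_exp {α : Type*} [Fintype α] [Nonempty α] (e : α → ℝ) {p : α → ℝ}
    (hp : p ∈ stdSimplex ℝ α) :
    ∑ a, -(p a * Real.log (p a)) + ∑ a, p a * e a ≤ Real.log (∑ a, Real.exp (e a)) := by
  have h := entropy_gap_eq e hp
  have hZ0 : 0 < ∑ b, Real.exp (e b) :=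
    Finset.sum_pos (fun a _ => Real.exp_pos _) Finset.univ_nonempty
  have : 0 ≤ ∑ a, Real.exp (e a) / (∑ b, Real.exp (e b)) *
        InformationTheory.klFun (p a / (Real.exp (e a) / ∑ b, Real.exp (e b))) :=
    Finset.sum_nonneg fun a _ => mul_nonneg (by positivity) <|
      InformationTheory.klFun_nonneg (div_nonneg (hp.1 a) (by positivity))
  linarith

lemma entropy_add_eq_log_sum_exp_iff {α : Type*} [Fintype α] [Nonempty α] (e : α → ℝ) {p : α → ℝ}
    (hp : p ∈ stdSimplex ℝ α) :
    ∑ a, -(p a * Real.log (p a)) + ∑ a, p a * e a = Real.log (∑ a, Real.exp (e a)) ↔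
      ∀ a, p a = Real.exp (e a) / ∑ b, Real.exp (e b) := by
  have hZ0 : 0 < ∑ b, Real.exp (e b) :=
    Finset.sum_pos (fun a _ => Real.exp_pos _) Finset.univ_nonempty
  have hq : ∀ a, 0 < Real.exp (e a) / ∑ b, Real.exp (e b) :=
    fun a => div_pos (Real.exp_pos _) hZ0
  rw [eq_comm, ← sub_eq_zero, entropy_gap_eq e hp, Finset.sum_eq_zero_iff_of_nonneg
    fun a _ => mul_nonneg (hq a).le <|
      InformationTheory.klFun_nonneg (div_nonneg (hp.1 a) (hq a).le)]
  refine forall_congr' fun a => ?_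
  rw [mul_eq_zero, or_iff_right (hq a).ne',
    InformationTheory.klFun_eq_zero_iff (div_nonneg (hp.1 a) (hq a).le), div_eq_one_iff_eq (hq a).ne']
  simp

/-- The second derivative `-1/x` is at most `-1` on `(0, 1]`. Only first derivatives are used: that
of the function with `x²/2` added is antitone. -/
lemma strongConcaveOn_negMulLog : StrongConcaveOn (Set.Icc (0 : ℝ) 1) 1 Real.negMulLog := by
  rw [strongConcaveOn_iff_convex]
  have hd : ∀ x : ℝ, x ≠ 0 → HasDerivAt (fun x : ℝ => Real.negMulLog x + 1 / (2 : ℝ) * ‖x‖ ^ 2)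
      (-Real.log x - 1 + x) x := by
    intro x hx
    simp only [Real.norm_eq_abs, sq_abs]
    exact ((Real.hasDerivAt_negMulLog hx).add
      (((hasDerivAt_id x).pow 2).const_mul (1 / 2 : ℝ))).congr_deriv (by simp)
  refine AntitoneOn.concaveOn_of_deriv (convex_Icc 0 1)
    (Continuous.continuousOn (Real.continuous_negMulLog.add (by fun_prop))) ?_ ?_
  · rw [interior_Icc]
    exact fun x hx => (hd x hx.1.ne').differentiableAt.differentiableWithinAt
  · rw [interior_Icc]
    intro x hx y hy hxy
    rw [(hd x hx.1.ne').deriv, (hd y hy.1.ne').deriv]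
    have h1 := Real.log_le_sub_one_of_pos (div_pos hx.1 hy.1)
    rw [Real.log_div hx.1.ne' hy.1.ne'] at h1
    -- Since `x ≤ y ≤ 1`, dividing `x - y` by `y` only lowers it, so `log x - log y ≤ x / y - 1 ≤ x
    -- - y`.
    have h2 : (x - y) * (1 - y) / y ≤ 0 :=
      div_nonpos_of_nonpos_of_nonneg
        (mul_nonpos_of_nonpos_of_nonneg (by linarith) (by linarith [hy.2])) hy.1.le
    have h3 : (x - y) * (1 - y) / y = x / y - 1 - (x - y) := by
      have := hy.1.ne'
      field_simp
    linarith

lemma entropy_convexComb_ge {α : Type*} [Fintype α] {p q : α → ℝ} (hp : p ∈ stdSimplex ℝ α)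
    (hq : q ∈ stdSimplex ℝ α) {s t : ℝ} (hs : 0 ≤ s) (ht : 0 ≤ t) (hst : s + t = 1) :
    s * ∑ a, -(p a * Real.log (p a)) + t * ∑ a, -(q a * Real.log (q a)) +
        s * t / 2 * ∑ a, (p a - q a) ^ 2 ≤
      ∑ a, -((s * p a + t * q a) * Real.log (s * p a + t * q a)) := by
  simp only [Finset.mul_sum, ← Finset.sum_add_distrib]
  refine Finset.sum_le_sum fun a _ => ?_
  have h := strongConcaveOn_negMulLog.2 ⟨hp.1 a, (mem_Icc_of_mem_stdSimplex hp a).2⟩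
    ⟨hq.1 a, (mem_Icc_of_mem_stdSimplex hq a).2⟩ hs ht hst
  simp only [Real.negMulLog, smul_eq_mul, Real.norm_eq_abs, sq_abs] at h
  linarith

namespace GameClass

universe u v w

/-! ### Measurability of families over outcome sets that vary with the game -/

section Measurability

variable {𝒢 : Type w} [MeasurableSpace 𝒢] {V : Type v} {C : GameClass.{u} 𝒢 V}

/-- Cutting `g l` off to the measurable set of games having label `l` restores the default value
`0`. Operations on families therefore need not map `0` to `0`. -/
lemma MeasurableFamily.of_label {E : Type*} [TopologicalSpace E] [Zero E]
    {h : ∀ Γ, C.Outcome Γ → E} {g : ℕ → 𝒢 → E} (hg : ∀ l, StronglyMeasurable (g l))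
    (heq : ∀ Γ a, g (C.label Γ a) Γ = h Γ a) : C.MeasurableFamily h := by
  classical
  intro l
  have : (fun Γ => Function.extend (C.label Γ) (h Γ) (fun _ => (0 : E)) l) =
      {Γ | ∃ a, C.label Γ a = l}.indicator (g l) := by
    funext Γ
    by_cases hl : ∃ a, C.label Γ a = l
    · obtain ⟨a, rfl⟩ := hl
      rw [(C.label_injective Γ).extend_apply, Set.indicator_of_mem (by exact ⟨a, rfl⟩), heq]
    · rw [Function.extend_apply' _ _ _ hl, Set.indicator_of_notMem (by exact hl)]
  rw [this]
  exact (hg l).indicator (C.measurableSet_label l)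

lemma MeasurableFamily.comp {E F : Type*} [TopologicalSpace E] [Zero E]
    [TopologicalSpace F] [Zero F] {h : ∀ Γ, C.Outcome Γ → E} (hh : C.MeasurableFamily h)
    {φ : E → F} (hφ : ∀ g : 𝒢 → E, StronglyMeasurable g → StronglyMeasurable (φ ∘ g)) :
    C.MeasurableFamily fun Γ a => φ (h Γ a) :=
  of_label (fun l => hφ _ (hh l)) fun Γ a => by
    simp only [Function.comp, (C.label_injective Γ).extend_apply]

lemma MeasurableFamily.comp₂ {E F H : Type*} [TopologicalSpace E] [Zero E]
    [TopologicalSpace F] [Zero F] [TopologicalSpace H] [Zero H]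
    {h : ∀ Γ, C.Outcome Γ → E} (hh : C.MeasurableFamily h)
    {k : ∀ Γ, C.Outcome Γ → F} (hk : C.MeasurableFamily k)
    {φ : E → F → H} (hφ : Continuous (Function.uncurry φ)) :
    C.MeasurableFamily fun Γ a => φ (h Γ a) (k Γ a) :=
  of_label (fun l => hφ.comp_stronglyMeasurable ((hh l).prodMk (hk l))) fun Γ a => by
    simp only [Function.uncurry, (C.label_injective Γ).extend_apply]

lemma MeasurableFamily.finset_sum {ι E : Type*} [TopologicalSpace E] [AddCommMonoid E]
    [ContinuousAdd E] (s : Finset ι)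
    {h : ι → ∀ Γ, C.Outcome Γ → E} (hh : ∀ i ∈ s, C.MeasurableFamily (h i)) :
    C.MeasurableFamily fun Γ a => ∑ i ∈ s, h i Γ a :=
  of_label (g := fun l Γ => ∑ i ∈ s,
      Function.extend (C.label Γ) (h i Γ) (fun _ => (0 : E)) l)
    (fun l => Finset.stronglyMeasurable_fun_sum s fun i hi => hh i hi l) fun Γ a => by
    simp only [(C.label_injective Γ).extend_apply]

/-- The number of outcomes may be unbounded over the class, so the sum is obtained as the pointwise
limit of sums over labels below `n`, eventually constant in each game. -/
lemma MeasurableFamily.sum_outcome {E : Type*} [TopologicalSpace E]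
    [TopologicalSpace.PseudoMetrizableSpace E] [AddCommMonoid E]
    [ContinuousAdd E] {h : ∀ Γ, C.Outcome Γ → E} (hh : C.MeasurableFamily h) :
    StronglyMeasurable fun Γ => ∑ a, h Γ a := by
  classical
  refine stronglyMeasurable_of_tendsto (u := Filter.atTop) (f := fun (n : ℕ) Γ =>
    ∑ l ∈ Finset.range n, Function.extend (C.label Γ) (h Γ) (fun _ => (0 : E)) l)
    (fun n => Finset.stronglyMeasurable_fun_sum _ fun l _ => hh l) ?_
  rw [tendsto_pi_nhds]
  intro Γ
  refine tendsto_const_nhds.congr' ?_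
  obtain ⟨N, hN⟩ : ∃ N, ∀ a, C.label Γ a < N :=
    ⟨(Finset.univ.sup (C.label Γ)) + 1, fun a =>
      Nat.lt_succ_of_le (Finset.le_sup (Finset.mem_univ a))⟩
  filter_upwards [Filter.eventually_ge_atTop N] with n hn
  have : Finset.univ.image (C.label Γ) ⊆ Finset.range n := by
    intro l hl
    obtain ⟨a, -, rfl⟩ := Finset.mem_image.1 hl
    exact Finset.mem_range.2 ((hN a).trans_le hn)
  rw [← Finset.sum_subset this, Finset.sum_image (fun a _ b _ hab => C.label_injective Γ hab)]
  · simp only [(C.label_injective Γ).extend_apply]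
  · intro l _ hl
    exact Function.extend_apply' _ _ _ fun ⟨a, ha⟩ => hl (Finset.mem_image.2 ⟨a, by simp, ha⟩)

lemma MeasurableFamily.of_tendsto {E : Type*} [TopologicalSpace E]
    [TopologicalSpace.PseudoMetrizableSpace E] [Zero E]
    {h : ℕ → ∀ Γ, C.Outcome Γ → E} (hh : ∀ n, C.MeasurableFamily (h n))
    {k : ∀ Γ, C.Outcome Γ → E}
    (hk : ∀ Γ a, Filter.Tendsto (fun n => h n Γ a) Filter.atTop (nhds (k Γ a))) :
    C.MeasurableFamily k := by
  intro l
  refine stronglyMeasurable_of_tendsto Filter.atTop (fun n => hh n l) ?_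
  rw [tendsto_pi_nhds]
  intro Γ
  by_cases hl : ∃ a, C.label Γ a = l
  · obtain ⟨a, rfl⟩ := hl
    simpa only [(C.label_injective Γ).extend_apply] using hk Γ a
  · simpa only [Function.extend_apply' _ _ _ hl] using tendsto_const_nhds

lemma MeasurableFamily.piecewise {E : Type*} [TopologicalSpace E] [Zero E]
    {S : Set 𝒢} (hS : MeasurableSet S) [DecidablePred (· ∈ S)]
    {h k : ∀ Γ, C.Outcome Γ → E} (hh : C.MeasurableFamily h) (hk : C.MeasurableFamily k) :
    C.MeasurableFamily fun Γ => if Γ ∈ S then h Γ else k Γ :=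
  of_label (g := fun l Γ => if Γ ∈ S then
      Function.extend (C.label Γ) (h Γ) (fun _ => (0 : E)) l else
      Function.extend (C.label Γ) (k Γ) (fun _ => (0 : E)) l)
    (fun l => StronglyMeasurable.ite (p := (· ∈ S)) hS (hh l) (hk l)) fun Γ a => by
    split_ifs <;> simp only [(C.label_injective Γ).extend_apply]

end Measurability

/-! ### Integrable bounds for entropy, regrets and the log-partition function -/

section Integrability

variable {𝒢 : Type w} [MeasurableSpace 𝒢] {V : Type v} {C : GameClass.{u} 𝒢 V}

lemma Strategy.nonempty_outcome (s : C.Strategy) (Γ : 𝒢) : Nonempty (C.Outcome Γ) := by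
  by_contra h
  rw [not_nonempty_iff] at h
  simpa using (s.prob Γ).2.2

lemma Strategy.entropy_nonneg (s : C.Strategy) (Γ : 𝒢) : 0 ≤ (C.game Γ).entropy (s.prob Γ) :=
  Finset.sum_nonneg fun a _ => neg_nonneg.2 <|
    Real.mul_log_nonpos ((s.prob Γ).2.1 a) (mem_Icc_of_mem_stdSimplex (s.prob Γ).2 a).2

lemma Strategy.entropy_le (s : C.Strategy) (Γ : 𝒢) :
    (C.game Γ).entropy (s.prob Γ) ≤ Real.log (Fintype.card (C.Outcome Γ)) := by
  have := s.nonempty_outcome Γ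
  simpa [VectorGame.entropy] using entropy_add_le_log_sum_exp (fun _ => 0) (s.prob Γ).2

lemma Strategy.stronglyMeasurable_entropy (s : C.Strategy) :
    StronglyMeasurable fun Γ => (C.game Γ).entropy (s.prob Γ) :=
  (s.measurable.comp (φ := fun x => -(x * Real.log x)) fun _ hg =>
    Real.continuous_mul_log.neg.comp_stronglyMeasurable hg).sum_outcome

lemma Strategy.integrable_entropy {ξ : Measure 𝒢}
    (hC : Integrable (fun Γ => Real.log (Fintype.card (C.Outcome Γ))) ξ) (s : C.Strategy) :
    Integrable (fun Γ => (C.game Γ).entropy (s.prob Γ)) ξ :=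
  hC.mono' s.stronglyMeasurable_entropy.aestronglyMeasurable <| .of_forall fun Γ => by
    rw [Real.norm_of_nonneg (s.entropy_nonneg Γ)]
    exact s.entropy_le Γ

variable [NormedAddCommGroup V] [InnerProductSpace ℝ V]

omit [InnerProductSpace ℝ V] in
lemma Deviation.norm_regret_le (f : C.Deviation) (Γ : 𝒢) (a : C.Outcome Γ) :
    ‖f.regret Γ a‖ ≤ ⨆ a, ‖f.regret Γ a‖ :=
  le_ciSup (f := fun a => ‖f.regret Γ a‖) (Set.finite_range _).bddAbove a

lemma norm_gameRegretFeatures_le (f : C.Deviation) (s : C.Strategy) (Γ : 𝒢) :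
    ‖gameRegretFeatures f s Γ‖ ≤ ⨆ a, ‖f.regret Γ a‖ :=
  calc ‖gameRegretFeatures f s Γ‖ ≤ ∑ a, (s.prob Γ).1 a * ⨆ a, ‖f.regret Γ a‖ :=
        norm_sum_le_of_le _ fun a _ => by
          rw [norm_smul, Real.norm_of_nonneg ((s.prob Γ).2.1 a)]
          exact mul_le_mul_of_nonneg_left (f.norm_regret_le Γ a) ((s.prob Γ).2.1 a)
    _ = ⨆ a, ‖f.regret Γ a‖ := by rw [← Finset.sum_mul, (s.prob Γ).2.2, one_mul]

lemma stronglyMeasurable_gameRegretFeatures (f : C.Deviation) (s : C.Strategy) :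
    StronglyMeasurable (gameRegretFeatures f s) :=
  (s.measurable.comp₂ f.measurable (φ := fun x y => x • y) continuous_smul).sum_outcome

lemma integrable_gameRegretFeatures {ξ : Measure 𝒢} {f : C.Deviation}
    (hf : Integrable (fun Γ => ⨆ a, ‖f.regret Γ a‖) ξ) (s : C.Strategy) :
    Integrable (gameRegretFeatures f s) ξ :=
  hf.mono' (stronglyMeasurable_gameRegretFeatures f s).aestronglyMeasurable <|
    .of_forall fun Γ => norm_gameRegretFeatures_le f s Γ

lemma sum_mul_inner_regret (f : C.Deviation) (s : C.Strategy) (w : V) (Γ : 𝒢) :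
    ∑ a, (s.prob Γ).1 a * ⟪f.regret Γ a, w⟫_ℝ = ⟪gameRegretFeatures f s Γ, w⟫_ℝ := by
  simp [gameRegretFeatures, sum_inner, inner_smul_left]

lemma integrable_sum_mul_inner_regret {ξ : Measure 𝒢} {f : C.Deviation}
    (hf : Integrable (fun Γ => ⨆ a, ‖f.regret Γ a‖) ξ) (s : C.Strategy) (w : V) :
    Integrable (fun Γ => ∑ a, (s.prob Γ).1 a * ⟪f.regret Γ a, w⟫_ℝ) ξ := by
  simp only [sum_mul_inner_regret]
  exact (integrable_gameRegretFeatures hf s).inner_const w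

lemma inner_regretFeatures [CompleteSpace V] {ξ : Measure 𝒢} {f : C.Deviation}
    (hf : Integrable (fun Γ => ⨆ a, ‖f.regret Γ a‖) ξ) (s : C.Strategy) (w : V) :
    ⟪regretFeatures ξ f s, w⟫_ℝ = expectedRegret ξ f s w := by
  simp only [expectedRegret, sum_mul_inner_regret, regretFeatures]
  rw [real_inner_comm, ← integral_inner (integrable_gameRegretFeatures hf s)]
  simp only [real_inner_comm]

variable {D : Type*}

lemma expWeight_measurableFamily (dev : D → C.Deviation) (Φ : Finset D) (θ : Φ → V) :
    C.MeasurableFamily (expWeight dev Φ θ) :=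
  (MeasurableFamily.finset_sum Finset.univ fun f _ =>
    (dev (f : Φ)).measurable.comp (φ := fun x => ⟪x, θ f⟫_ℝ) fun _ hg =>
      hg.inner stronglyMeasurable_const).comp (φ := fun x => Real.exp (-x)) fun _ hg =>
      (Real.continuous_exp.comp continuous_neg).comp_stronglyMeasurable hg

lemma partitionFunction_pos (dev : D → C.Deviation) (Φ : Finset D) (θ : Φ → V) (Γ : 𝒢)
    [Nonempty (C.Outcome Γ)] : 0 < partitionFunction dev Φ θ Γ :=
  Finset.sum_pos (fun _ _ => Real.exp_pos _) Finset.univ_nonempty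

lemma stronglyMeasurable_partitionFunction (dev : D → C.Deviation) (Φ : Finset D) (θ : Φ → V) :
    StronglyMeasurable (partitionFunction dev Φ θ) :=
  (expWeight_measurableFamily dev Φ θ).sum_outcome

/-- Each weight lies between `exp (-M)` and `exp M`, by Cauchy–Schwarz. The bound is integrable
under the two standing hypotheses. -/
lemma abs_log_partitionFunction_le (dev : D → C.Deviation) (Φ : Finset D) (θ : Φ → V) (Γ : 𝒢)
    [Nonempty (C.Outcome Γ)] :
    |Real.log (partitionFunction dev Φ θ Γ)| ≤ Real.log (Fintype.card (C.Outcome Γ)) +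
      ∑ f : Φ, (⨆ a, ‖(dev f).regret Γ a‖) * ‖θ f‖ := by
  set M := ∑ f : Φ, (⨆ a, ‖(dev f).regret Γ a‖) * ‖θ f‖ with hM
  have hb : ∀ a, |∑ f : Φ, ⟪(dev f).regret Γ a, θ f⟫_ℝ| ≤ M := fun a =>
    (Finset.abs_sum_le_sum_abs _ _).trans <| Finset.sum_le_sum fun f _ =>
      (abs_real_inner_le_norm _ _).trans <|
        mul_le_mul_of_nonneg_right ((dev f).norm_regret_le Γ a) (norm_nonneg _)
  have hcard : (0 : ℝ) < Fintype.card (C.Outcome Γ) := by exact_mod_cast Fintype.card_pos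
  have hcard1 : 0 ≤ Real.log (Fintype.card (C.Outcome Γ)) :=
    Real.log_nonneg (by exact_mod_cast Nat.succ_le_of_lt Fintype.card_pos)
  have hup : partitionFunction dev Φ θ Γ ≤ Fintype.card (C.Outcome Γ) * Real.exp M :=
    (Finset.sum_le_card_nsmul _ _ (Real.exp M) fun a _ =>
      Real.exp_le_exp.2 (by linarith [(abs_le.1 (hb a)).1])).trans_eq (by simp)
  have hlo : Fintype.card (C.Outcome Γ) * Real.exp (-M) ≤ partitionFunction dev Φ θ Γ :=
    (Eq.trans_le (by simp) (Finset.card_nsmul_le_sum Finset.univ _ (Real.exp (-M)) fun a _ =>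
      Real.exp_le_exp.2 (by linarith [(abs_le.1 (hb a)).2])))
  have h1 := Real.log_le_log (partitionFunction_pos dev Φ θ Γ) hup
  have h2 := Real.log_le_log (by positivity) hlo
  rw [Real.log_mul hcard.ne' (Real.exp_pos _).ne', Real.log_exp] at h1 h2
  exact abs_le.2 ⟨by linarith, h1⟩

lemma integrable_log_partitionFunction {ξ : Measure 𝒢}
    (hC : Integrable (fun Γ => Real.log (Fintype.card (C.Outcome Γ))) ξ)
    (hne : ∀ Γ, Nonempty (C.Outcome Γ)) {dev : D → C.Deviation}
    (hdev : ∀ f, Integrable (fun Γ => ⨆ a, ‖(dev f).regret Γ a‖) ξ) (Φ : Finset D) (θ : Φ → V) :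
    Integrable (fun Γ => Real.log (partitionFunction dev Φ θ Γ)) ξ :=
  (hC.add (integrable_finsetSum Finset.univ fun (f : Φ) _ =>
    (hdev f).mul_const ‖θ f‖)).mono'
    (Real.measurable_log.comp
      (stronglyMeasurable_partitionFunction dev Φ θ).measurable).aestronglyMeasurable <|
    .of_forall fun Γ => abs_log_partitionFunction_le dev Φ θ Γ

/-- The exponential-family (Gibbs) strategy with weights `θ`. -/
def gibbs (hne : ∀ Γ, Nonempty (C.Outcome Γ)) (dev : D → C.Deviation) (Φ : Finset D) (θ : Φ → V) :
    C.Strategy where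
  prob Γ := ⟨fun a => expWeight dev Φ θ Γ a / partitionFunction dev Φ θ Γ, fun _ =>
      div_nonneg (Real.exp_pos _).le (partitionFunction_pos dev Φ θ Γ).le, by
    rw [← Finset.sum_div]
    exact div_self (partitionFunction_pos dev Φ θ Γ).ne'⟩
  measurable := by
    refine MeasurableFamily.of_label (fun l =>
      (expWeight_measurableFamily dev Φ θ l).div (stronglyMeasurable_partitionFunction dev Φ θ)) ?_
    intro Γ a
    simp only [Pi.div_apply, (C.label_injective Γ).extend_apply]

end Integrability

end GameClass

namespace GameClass

universe u v w

variable {𝒢 : Type w} [MeasurableSpace 𝒢] {V : Type v} {C : GameClass.{u} 𝒢 V}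

/-! ### Convex combinations of strategies -/

/-- The game-wise convex combination of two strategies. -/
def Strategy.convexComb (s t : C.Strategy) {a b : ℝ} (ha : 0 ≤ a) (hb : 0 ≤ b) (hab : a + b = 1) :
    C.Strategy where
  prob Γ := ⟨a • (s.prob Γ).1 + b • (t.prob Γ).1,
    convex_stdSimplex ℝ _ (s.prob Γ).2 (t.prob Γ).2 ha hb hab⟩
  measurable := s.measurable.comp₂ t.measurable (φ := fun x y => a * x + b * y)
    (by unfold Function.uncurry; fun_prop)

/-- The squared Euclidean distance of two strategies in the game `Γ`. -/
def Strategy.sqDist (s t : C.Strategy) (Γ : 𝒢) : ℝ :=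
  ∑ a, ((s.prob Γ).1 a - (t.prob Γ).1 a) ^ 2

lemma Strategy.sqDist_nonneg (s t : C.Strategy) (Γ : 𝒢) : 0 ≤ s.sqDist t Γ :=
  Finset.sum_nonneg fun _ _ => sq_nonneg _

lemma Strategy.sqDist_le_two (s t : C.Strategy) (Γ : 𝒢) : s.sqDist t Γ ≤ 2 :=
  calc s.sqDist t Γ ≤ ∑ a, ((s.prob Γ).1 a + (t.prob Γ).1 a) := Finset.sum_le_sum fun a _ => by
        have hs := mem_Icc_of_mem_stdSimplex (s.prob Γ).2 a
        have ht := mem_Icc_of_mem_stdSimplex (t.prob Γ).2 a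
        nlinarith [hs.1, hs.2, ht.1, ht.2, mul_nonneg hs.1 ht.1]
    _ = 2 := by rw [Finset.sum_add_distrib, (s.prob Γ).2.2, (t.prob Γ).2.2]; norm_num

lemma Strategy.stronglyMeasurable_sqDist (s t : C.Strategy) : StronglyMeasurable (s.sqDist t) :=
  (s.measurable.comp₂ t.measurable (φ := fun x y => (x - y) ^ 2)
    (by unfold Function.uncurry; fun_prop)).sum_outcome

lemma Strategy.integrable_sqDist {ξ : Measure 𝒢} [IsFiniteMeasure ξ] (s t : C.Strategy) :
    Integrable (s.sqDist t) ξ :=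
  (integrable_const (2 : ℝ)).mono' (s.stronglyMeasurable_sqDist t).aestronglyMeasurable <|
    .of_forall fun Γ => by
      rw [Real.norm_of_nonneg (s.sqDist_nonneg t Γ)]
      exact s.sqDist_le_two t Γ

/-- The quadratic term is what later turns near-optimality into closeness of strategies. -/
lemma condEntropy_convexComb_ge {ξ : Measure 𝒢} [IsFiniteMeasure ξ]
    (hC : Integrable (fun Γ => Real.log (Fintype.card (C.Outcome Γ))) ξ)
    (s t : C.Strategy) {a b : ℝ} (ha : 0 ≤ a) (hb : 0 ≤ b) (hab : a + b = 1) :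
    a * condEntropy ξ s + b * condEntropy ξ t + a * b / 2 * ∫ Γ, s.sqDist t Γ ∂ξ ≤
      condEntropy ξ (s.convexComb t ha hb hab) := by
  have hs := (s.integrable_entropy hC).const_mul a
  have ht := (t.integrable_entropy hC).const_mul b
  have hd := (s.integrable_sqDist (ξ := ξ) t).const_mul (a * b / 2)
  have hst : Integrable (fun Γ => a * (C.game Γ).entropy (s.prob Γ) +
    b * (C.game Γ).entropy (t.prob Γ)) ξ := hs.add ht
  simp only [condEntropy]
  rw [← integral_const_mul, ← integral_const_mul, ← integral_const_mul,
    ← integral_add hs ht, ← integral_add hst hd]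
  refine integral_mono (hst.add hd) (Strategy.integrable_entropy hC _) fun Γ => ?_
  exact entropy_convexComb_ge (s.prob Γ).2 (t.prob Γ).2 ha hb hab

variable [NormedAddCommGroup V] [InnerProductSpace ℝ V]

lemma gameRegretFeatures_convexComb (f : C.Deviation)
    (s t : C.Strategy) {a b : ℝ} (ha : 0 ≤ a) (hb : 0 ≤ b) (hab : a + b = 1) (Γ : 𝒢) :
    gameRegretFeatures f (s.convexComb t ha hb hab) Γ =
      a • gameRegretFeatures f s Γ + b • gameRegretFeatures f t Γ := by
  simp only [gameRegretFeatures, Strategy.convexComb, Finset.smul_sum, ← Finset.sum_add_distrib,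
    smul_smul, ← add_smul, Pi.add_apply, Pi.smul_apply, smul_eq_mul]

lemma regretFeatures_convexComb {ξ : Measure 𝒢} {f : C.Deviation}
    (hf : Integrable (fun Γ => ⨆ a, ‖f.regret Γ a‖) ξ)
    (s t : C.Strategy) {a b : ℝ} (ha : 0 ≤ a) (hb : 0 ≤ b) (hab : a + b = 1) :
    regretFeatures ξ f (s.convexComb t ha hb hab) =
      a • regretFeatures ξ f s + b • regretFeatures ξ f t := by
  simp only [regretFeatures, gameRegretFeatures_convexComb]
  rw [integral_add ((integrable_gameRegretFeatures hf s).fun_smul a)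
    ((integrable_gameRegretFeatures hf t).fun_smul b), integral_smul, integral_smul]

/-! ### Continuity along almost everywhere convergent sequences -/

omit [NormedAddCommGroup V] [InnerProductSpace ℝ V] in
lemma tendsto_condEntropy {ξ : Measure 𝒢}
    (hC : Integrable (fun Γ => Real.log (Fintype.card (C.Outcome Γ))) ξ)
    {s : ℕ → C.Strategy} {t : C.Strategy}
    (h : ∀ᵐ Γ ∂ξ, ∀ a, Filter.Tendsto (fun n => ((s n).prob Γ).1 a) Filter.atTop
      (nhds ((t.prob Γ).1 a))) :
    Filter.Tendsto (fun n => condEntropy ξ (s n)) Filter.atTop (nhds (condEntropy ξ t)) := by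
  refine tendsto_integral_of_dominated_convergence _
    (fun n => (s n).stronglyMeasurable_entropy.aestronglyMeasurable) hC
    (fun n => .of_forall fun Γ => ?_) ?_
  · rw [Real.norm_of_nonneg ((s n).entropy_nonneg Γ)]
    exact (s n).entropy_le Γ
  · filter_upwards [h] with Γ hΓ
    exact tendsto_finsetSum _ fun a _ =>
      ((Real.continuous_mul_log.tendsto _).comp (hΓ a)).neg

lemma tendsto_regretFeatures {ξ : Measure 𝒢} {f : C.Deviation}
    (hf : Integrable (fun Γ => ⨆ a, ‖f.regret Γ a‖) ξ)
    {s : ℕ → C.Strategy} {t : C.Strategy}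
    (h : ∀ᵐ Γ ∂ξ, ∀ a, Filter.Tendsto (fun n => ((s n).prob Γ).1 a) Filter.atTop
      (nhds ((t.prob Γ).1 a))) :
    Filter.Tendsto (fun n => regretFeatures ξ f (s n)) Filter.atTop
      (nhds (regretFeatures ξ f t)) := by
  refine tendsto_integral_of_dominated_convergence _
    (fun n => (stronglyMeasurable_gameRegretFeatures f (s n)).aestronglyMeasurable) hf
    (fun n => .of_forall fun Γ => norm_gameRegretFeatures_le f (s n) Γ) ?_
  filter_upwards [h] with Γ hΓ
  exact tendsto_finsetSum _ fun a _ => (hΓ a).smul_const _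

/-! ### Completeness of the set of strategies -/

omit [NormedAddCommGroup V] [InnerProductSpace ℝ V] in
lemma exists_strategy_tendsto_ae {ξ : Measure 𝒢} {s : ℕ → C.Strategy}
    (h : ∀ᵐ Γ ∂ξ, ∀ a, CauchySeq fun n => ((s n).prob Γ).1 a) :
    ∃ t : C.Strategy, ∀ᵐ Γ ∂ξ, ∀ a,
      Filter.Tendsto (fun n => ((s n).prob Γ).1 a) Filter.atTop (nhds ((t.prob Γ).1 a)) := by
  classical
  -- On a measurable null set containing the bad games every term is replaced by `s 0`; the modified
  -- sequence converges in every game and stays a measurable family.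
  obtain ⟨N, hbad, hN, hN0⟩ := exists_measurable_superset_of_null (ae_iff.1 h)
  have hlim : ∀ Γ, ∃ p : stdSimplex ℝ (C.Outcome Γ), ∀ a, Filter.Tendsto
      (fun n => if Γ ∈ N then ((s 0).prob Γ).1 a else ((s n).prob Γ).1 a)
      Filter.atTop (nhds (p.1 a)) := by
    intro Γ
    by_cases hΓ : Γ ∈ N
    · exact ⟨(s 0).prob Γ, fun a => by simpa only [hΓ, if_true] using tendsto_const_nhds⟩
    · have hc : ∀ a, CauchySeq fun n => ((s n).prob Γ).1 a := by
        by_contra hcon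
        exact hΓ (hbad hcon)
      choose p hp using fun a => cauchySeq_tendsto_of_complete (hc a)
      exact ⟨⟨p, (isClosed_stdSimplex ℝ _).mem_of_tendsto (tendsto_pi_nhds.2 hp)
        (.of_forall fun n => ((s n).prob Γ).2)⟩, by simpa only [hΓ, if_false] using hp⟩
  choose p hp using hlim
  refine ⟨⟨p, MeasurableFamily.of_tendsto
    (fun n => MeasurableFamily.piecewise hN (s 0).measurable (s n).measurable)
    fun Γ a => (hp Γ a).congr fun n => by split_ifs <;> rfl⟩, ?_⟩
  filter_upwards [compl_mem_ae_iff.2 hN0] with Γ hΓ a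
  have hΓ' : Γ ∉ N := hΓ
  simpa only [hΓ', if_false] using hp Γ a

omit [NormedAddCommGroup V] [InnerProductSpace ℝ V] in
-- The Riesz–Fischer argument: weighted by `4 ^ n`, the squared distances have integrals at most
-- `(1/2) ^ n`, so their sum `B` is finite almost everywhere and the `n`-th step is at most `√B *
-- (1/2) ^ n`.
lemma ae_cauchySeq_of_integral_sqDist_le {ξ : Measure 𝒢} [IsFiniteMeasure ξ] {s : ℕ → C.Strategy}
    (h : ∀ n, ∫ Γ, (s n).sqDist (s (n + 1)) Γ ∂ξ ≤ (1 / 8) ^ n) :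
    ∀ᵐ Γ ∂ξ, ∀ a, CauchySeq fun n => ((s n).prob Γ).1 a := by
  have hmeas : ∀ n, Measurable fun Γ => ENNReal.ofReal (4 ^ n * (s n).sqDist (s (n + 1)) Γ) :=
    fun n => (((s n).stronglyMeasurable_sqDist _).measurable.const_mul _).ennreal_ofReal
  have hsum : ∫⁻ Γ, ∑' n, ENNReal.ofReal (4 ^ n * (s n).sqDist (s (n + 1)) Γ) ∂ξ ≠ ⊤ := by
    rw [lintegral_tsum fun n => (hmeas n).aemeasurable]
    have hle : ∀ n, ∫⁻ Γ, ENNReal.ofReal (4 ^ n * (s n).sqDist (s (n + 1)) Γ) ∂ξ ≤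
        ENNReal.ofReal ((1 / 2) ^ n) := by
      intro n
      rw [← ofReal_integral_eq_lintegral_ofReal (((s n).integrable_sqDist _).const_mul _)
        (.of_forall fun Γ => mul_nonneg (by positivity) ((s n).sqDist_nonneg _ Γ)),
        integral_const_mul]
      refine ENNReal.ofReal_le_ofReal ((mul_le_mul_of_nonneg_left (h n) (by positivity)).trans ?_)
      rw [← mul_pow]; norm_num
    refine ne_top_of_le_ne_top ?_ (ENNReal.tsum_le_tsum hle)
    rw [← ENNReal.ofReal_tsum_of_nonneg (fun n => by positivity) summable_geometric_two]
    exact ENNReal.ofReal_ne_top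
  filter_upwards [ae_lt_top (Measurable.tsum hmeas) hsum] with Γ hΓ a
  set B := ∑' n, ENNReal.ofReal (4 ^ n * (s n).sqDist (s (n + 1)) Γ)
  refine cauchySeq_of_le_geometric (1 / 2) (Real.sqrt B.toReal) (by norm_num) fun n => ?_
  have h1 : 4 ^ n * (s n).sqDist (s (n + 1)) Γ ≤ B.toReal := by
    rw [← ENNReal.ofReal_le_iff_le_toReal hΓ.ne]
    exact ENNReal.le_tsum n
  have h2 : (((s n).prob Γ).1 a - ((s (n + 1)).prob Γ).1 a) ^ 2 ≤ (s n).sqDist (s (n + 1)) Γ :=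
    Finset.single_le_sum (f := fun a => (((s n).prob Γ).1 a - ((s (n + 1)).prob Γ).1 a) ^ 2)
      (fun _ _ => sq_nonneg _) (Finset.mem_univ a)
  rw [Real.dist_eq, ← Real.sqrt_sq (show (0 : ℝ) ≤ (1 / 2) ^ n by positivity),
    ← Real.sqrt_mul ENNReal.toReal_nonneg]
  refine Real.abs_le_sqrt ?_
  have h4 : (4 : ℝ) ^ n * ((1 / 2) ^ n) ^ 2 = 1 := by
    rw [← pow_mul, mul_comm n 2, pow_mul, ← mul_pow]; norm_num
  have h3 := mul_le_mul_of_nonneg_right ((mul_le_mul_of_nonneg_left h2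
    (by positivity : (0 : ℝ) ≤ 4 ^ n)).trans h1) (by positivity : (0 : ℝ) ≤ ((1 / 2) ^ n) ^ 2)
  linear_combination h3 - (((s n).prob Γ).1 a - ((s (n + 1)).prob Γ).1 a) ^ 2 * h4

omit [NormedAddCommGroup V] [InnerProductSpace ℝ V] in
lemma exists_subseq_tendsto_ae {ξ : Measure 𝒢} [IsFiniteMeasure ξ] {s : ℕ → C.Strategy}
    (h : ∀ ε > 0, ∃ N, ∀ m ≥ N, ∀ n ≥ N, ∫ Γ, (s m).sqDist (s n) Γ ∂ξ ≤ ε) :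
    ∃ φ : ℕ → ℕ, StrictMono φ ∧ ∃ t : C.Strategy, ∀ᵐ Γ ∂ξ, ∀ a,
      Filter.Tendsto (fun n => ((s (φ n)).prob Γ).1 a) Filter.atTop (nhds ((t.prob Γ).1 a)) := by
  obtain ⟨φ, hφ, hφ'⟩ := Filter.extraction_forall_of_eventually'
    (P := fun k N => ∀ n ≥ N, ∫ Γ, (s N).sqDist (s n) Γ ∂ξ ≤ (1 / 8) ^ k) fun k => by
      obtain ⟨N, hN⟩ := h ((1 / 8) ^ k) (by positivity)
      exact ⟨N, fun m hm n hn => hN m hm n (hm.trans hn)⟩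
  exact ⟨φ, hφ, exists_strategy_tendsto_ae (s := fun n => s (φ n)) <|
    ae_cauchySeq_of_integral_sqDist_le fun n => hφ' n _ (hφ n.lt_succ_self).le⟩

end GameClass

/-! ### Weak duality and separation for conic programs -/

namespace ConicProgram

variable {X ι W : Type*} [NormedAddCommGroup W] [InnerProductSpace ℝ W]

/-- Pairing the cone element `u i - P.constraint i x` with a dual multiplier is nonnegative. Taking
`u = 0` gives weak duality; general `u` controls almost feasible points. -/
lemma objective_le_lagrangian_add [Fintype ι] [CompleteSpace W] (P : ConicProgram X ι W) {x : X}
    {u θ : ι → W} (hx : ∀ i, u i - P.constraint i x ∈ P.cone i) (hθ : P.DualFeasible θ) :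
    P.objective x ≤ P.lagrangian x θ + ∑ i, ⟪u i, θ i⟫_ℝ := by
  have h : ∑ i, ⟪P.constraint i x, θ i⟫_ℝ ≤ ∑ i, ⟪u i, θ i⟫_ℝ :=
    Finset.sum_le_sum fun i _ => by
      have := ProperCone.mem_innerDual.1 (hθ i) (hx i)
      rw [inner_sub_left] at this
      linarith
  rw [lagrangian]
  linarith

lemma lagrangian_add_smul [Fintype ι] (P : ConicProgram X ι W) (x : X)
    (θ θ' : ι → W) (c : ℝ) :
    P.lagrangian x (θ + c • θ') = P.lagrangian x θ - c * ∑ i, ⟪P.constraint i x, θ' i⟫_ℝ := by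
  simp only [lagrangian, Pi.add_apply, Pi.smul_apply, inner_add_right, inner_smul_right,
    Finset.sum_add_distrib, Finset.mul_sum]
  ring

lemma value_le_dualValue [Fintype ι] [CompleteSpace W] (P : ConicProgram X ι W) :
    P.value ≤ P.dualValue := by
  refine iSup₂_le fun x hx => le_iInf₂ fun θ hθ => ?_
  refine le_trans (EReal.coe_le_coe_iff.2 ?_) (le_iSup (fun x => (P.lagrangian x θ : EReal)) x)
  simpa using P.objective_le_lagrangian_add (u := 0)
    (fun i => by simpa using hx i) hθ

/-- If a real number `v` is a lower bound of the dual of a concave program, then there are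
asymptotically feasible points whose objective is asymptotically at least `v`. -/
lemma exists_asymptotically_feasible [Fintype ι] [CompleteSpace W] (P : ConicProgram X ι W)
    [Nonempty X]
    (hconc : ∀ x y : X, ∀ a b : ℝ, 0 ≤ a → 0 ≤ b → a + b = 1 → ∃ z,
      a * P.objective x + b * P.objective y ≤ P.objective z ∧
      ∀ i, P.constraint i z = a • P.constraint i x + b • P.constraint i y)
    {θ₀ : ι → W} (hθ₀ : P.DualFeasible θ₀) {M : ℝ} (hM : ∀ x, P.lagrangian x θ₀ ≤ M)
    {v : ℝ} (hv : ∀ θ, P.DualFeasible θ → ∀ m : ℝ, (∀ x, P.lagrangian x θ ≤ m) → v ≤ m) :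
    ∃ (x : ℕ → X) (u : ℕ → ι → W) (t : ℕ → ℝ),
      (∀ n i, u n i - P.constraint i (x n) ∈ P.cone i) ∧ (∀ n, t n ≤ P.objective (x n)) ∧
      Filter.Tendsto u Filter.atTop (nhds 0) ∧ Filter.Tendsto t Filter.atTop (nhds v) := by
  classical
  -- The pairs of a constraint perturbation and an objective level achievable under it; concavity
  -- makes this set convex.
  let A : Set ((ι → W) × ℝ) := {p | ∃ x, (∀ i, p.1 i - P.constraint i x ∈ P.cone i) ∧
    p.2 ≤ P.objective x}
  suffices h : ((0 : ι → W), v) ∈ closure A by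
    obtain ⟨p, hp, hlim⟩ := mem_closure_iff_seq_limit.1 h
    choose x hx using hp
    rw [Prod.tendsto_iff] at hlim
    exact ⟨x, fun n => (p n).1, fun n => (p n).2, fun n => (hx n).1, fun n => (hx n).2,
      hlim.1, hlim.2⟩
  have hA : Convex ℝ A := by
    rintro p ⟨x, hx, hx'⟩ q ⟨y, hy, hy'⟩ a b ha hb hab
    obtain ⟨z, hz, hz'⟩ := hconc x y a b ha hb hab
    refine ⟨z, fun i => ?_, le_trans ?_ hz⟩
    · have : (a • p + b • q).1 i - P.constraint i z =
          a • (p.1 i - P.constraint i x) + b • (q.1 i - P.constraint i y) := by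
        simp only [hz', Prod.fst_add, Prod.smul_fst, Pi.add_apply, Pi.smul_apply, smul_sub]
        abel
      rw [this]
      exact add_mem ((P.cone i).smul_mem (hx i) ha) ((P.cone i).smul_mem (hy i) hb)
    · simp only [Prod.snd_add, Prod.smul_snd, smul_eq_mul]
      gcongr
  by_contra hnot
  obtain ⟨F, s, hFs, hs⟩ := geometric_hahn_banach_closed_point hA.closure isClosed_closure hnot
  replace hFs : ∀ p ∈ A, F p < s := fun p hp => hFs p (subset_closure hp)
  let G : ι → StrongDual ℝ W := fun i => F.comp
    ((ContinuousLinearMap.inl ℝ (ι → W) ℝ).comp (ContinuousLinearMap.single ℝ (fun _ => W) i))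
  -- The minus sign in the Riesz representative makes `θ` dual feasible.
  let θ : ι → W := fun i => -(InnerProductSpace.toDual ℝ W).symm (G i)
  let μ : ℝ := F (0, 1)
  have hG : ∀ i w, F (Pi.single i w, 0) = -⟪w, θ i⟫_ℝ := by
    intro i w
    have : ⟪(InnerProductSpace.toDual ℝ W).symm (G i), w⟫_ℝ = G i w :=
      InnerProductSpace.toDual_symm_apply
    rw [inner_neg_right, neg_neg, real_inner_comm, this]
    rfl
  have hF : ∀ p, F p = -∑ i, ⟪p.1 i, θ i⟫_ℝ + μ * p.2 := by
    rintro ⟨w, t⟩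
    have h1 : ((w, t) : (ι → W) × ℝ) = ∑ i, (Pi.single i (w i), 0) + t • (0, 1) := by
      ext i
      · simp [Prod.fst_sum, Finset.sum_apply, Finset.sum_pi_single]
      · simp [Prod.snd_sum]
    conv_lhs => rw [h1]
    rw [map_add, map_sum, map_smul, smul_eq_mul]
    simp only [hG, Finset.sum_neg_distrib, μ, mul_comm]
  obtain ⟨x₀⟩ := ‹Nonempty X›
  -- `A` is closed under lowering the level, so a negative `μ` would make `F` unbounded above on it;
  -- the chosen decrease already reaches `s`.
  have hμ : 0 ≤ μ := by
    by_contra! hneg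
    have h1 : ∀ c : ℝ, 0 ≤ c → -∑ i, ⟪P.constraint i x₀, θ i⟫_ℝ + μ * (P.objective x₀ - c) < s := by
      intro c hc
      have := hFs (fun i => P.constraint i x₀, P.objective x₀ - c)
        ⟨x₀, fun i => by simp, by simpa using hc⟩
      rwa [hF] at this
    have h2 := h1 (max 0 ((s + ∑ i, ⟪P.constraint i x₀, θ i⟫_ℝ - μ * P.objective x₀) / -μ))
      (le_max_left _ _)
    have h3 := mul_le_mul_of_nonneg_left (le_max_right 0
      ((s + ∑ i, ⟪P.constraint i x₀, θ i⟫_ℝ - μ * P.objective x₀) / -μ)) (neg_pos.2 hneg).le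
    rw [mul_div_cancel₀ _ (neg_pos.2 hneg).ne'] at h3
    linarith
  -- `A` is also closed under adding cone elements to the perturbation, so a negative pairing with
  -- some `k` would again make `F` unbounded above.
  have hθ : P.DualFeasible θ := by
    intro i
    rw [ProperCone.mem_innerDual]
    intro k hk
    by_contra! hneg
    have h1 : ∀ c : ℝ, 0 ≤ c → -∑ i, ⟪P.constraint i x₀, θ i⟫_ℝ - c * ⟪k, θ i⟫_ℝ +
        μ * P.objective x₀ < s := by
      intro c hc
      have := hFs ((fun i => P.constraint i x₀) + Pi.single i (c • k), P.objective x₀)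
        ⟨x₀, fun j => by
          rcases eq_or_ne j i with rfl | hj
          · simpa using (P.cone j).smul_mem hk hc
          · simp [hj], le_rfl⟩
      rw [hF] at this
      have h2 : ∑ j, ⟪((fun i => P.constraint i x₀) + Pi.single i (c • k) : ι → W) j, θ j⟫_ℝ =
          ∑ i, ⟪P.constraint i x₀, θ i⟫_ℝ + c * ⟪k, θ i⟫_ℝ := by
        simp only [Pi.add_apply, inner_add_left, Finset.sum_add_distrib]
        congr 1
        rw [Finset.sum_eq_single i]
        · simp [inner_smul_left]
        · intro j _ hj; simp [hj]
        · simp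
      rw [h2] at this
      linarith
    have h2 := h1 (max 0 ((s + ∑ i, ⟪P.constraint i x₀, θ i⟫_ℝ - μ * P.objective x₀) /
      -⟪k, θ i⟫_ℝ)) (le_max_left _ _)
    have h3 := mul_le_mul_of_nonneg_left (le_max_right 0
      ((s + ∑ i, ⟪P.constraint i x₀, θ i⟫_ℝ - μ * P.objective x₀) / -⟪k, θ i⟫_ℝ))
      (neg_pos.2 hneg).le
    rw [mul_div_cancel₀ _ (neg_pos.2 hneg).ne'] at h3
    linarith
  have hx : ∀ x, -∑ i, ⟪P.constraint i x, θ i⟫_ℝ + μ * P.objective x < s := by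
    intro x
    have := hFs (fun i => P.constraint i x, P.objective x) ⟨x, fun i => by simp, le_rfl⟩
    rwa [hF] at this
  have hs' : s < μ * v := by simpa [hF] using hs
  rcases hμ.eq_or_lt with hμ0 | hμ0
  -- A vertical hyperplane, the case a Slater condition would exclude. Here `s < 0`, so moving from
  -- `θ₀` along `θ` lowers the Lagrangian bound linearly; this step length brings it to `M - |M - v|
  -- - 1 < v`.
  · rw [← hμ0, zero_mul] at hs'
    have hc : 0 ≤ (|M - v| + 1) / -s := div_nonneg (by positivity) (by linarith)
    have h1 := hv (θ₀ + ((|M - v| + 1) / -s) • θ)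
      (fun i => add_mem (hθ₀ i) ((ProperCone.innerDual _).smul_mem (hθ i) hc))
      (M + (|M - v| + 1) / -s * s) fun x => by
        rw [lagrangian_add_smul]
        have h2 : -∑ i, ⟪P.constraint i x, θ i⟫_ℝ ≤ s := by
          have := hx x
          rw [← hμ0] at this
          linarith
        have := mul_le_mul_of_nonneg_left h2 hc
        linarith [hM x]
    have h3 : (|M - v| + 1) / -s * s = -(|M - v| + 1) := by field_simp [hs'.ne]
    linarith [neg_abs_le (M - v), le_abs_self (M - v)]
  -- Normalizing the objective coefficient to `1` gives a dual bound `s / μ < v`.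
  · have h1 := hv (μ⁻¹ • θ) (fun i => (ProperCone.innerDual _).smul_mem (hθ i) (inv_pos.2 hμ0).le)
      (μ⁻¹ * s) fun x => by
        have := mul_le_mul_of_nonneg_left (hx x).le (inv_pos.2 hμ0).le
        simp only [lagrangian, Pi.smul_apply, inner_smul_right, ← Finset.mul_sum]
        rw [mul_add, inv_mul_cancel_left₀ hμ0.ne'] at this
        linarith
    have h2 := mul_lt_mul_of_pos_left hs' (inv_pos.2 hμ0)
    rw [inv_mul_cancel_left₀ hμ0.ne'] at h2
    linarith

end ConicProgram

namespace GameClass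

universe u v w

variable {𝒢 : Type w} [MeasurableSpace 𝒢] {V : Type v} {C : GameClass.{u} 𝒢 V}
  [NormedAddCommGroup V] [InnerProductSpace ℝ V] {D : Type*}

/-! ### The Lagrangian of a single game -/

/-- The entropy of `s` in the game `Γ` minus its expected regrets under the weights `θ`. -/
def gameLagrangian (dev : D → C.Deviation) (Φ : Finset D) (θ : Φ → V) (s : C.Strategy) (Γ : 𝒢) :
    ℝ :=
  (C.game Γ).entropy (s.prob Γ) - ∑ f : Φ, ∑ a, (s.prob Γ).1 a * ⟪(dev f).regret Γ a, θ f⟫_ℝ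

lemma gameLagrangian_eq (dev : D → C.Deviation) (Φ : Finset D) (θ : Φ → V) (s : C.Strategy)
    (Γ : 𝒢) : gameLagrangian dev Φ θ s Γ =
      ∑ a, -((s.prob Γ).1 a * Real.log ((s.prob Γ).1 a)) +
      ∑ a, (s.prob Γ).1 a * -∑ f : Φ, ⟪(dev f).regret Γ a, θ f⟫_ℝ := by
  rw [gameLagrangian, Finset.sum_comm, sub_eq_add_neg, ← Finset.sum_neg_distrib]
  simp only [mul_neg, Finset.mul_sum]
  rfl

lemma gameLagrangian_le (dev : D → C.Deviation) (Φ : Finset D) (θ : Φ → V) (s : C.Strategy)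
    (Γ : 𝒢) : gameLagrangian dev Φ θ s Γ ≤ Real.log (partitionFunction dev Φ θ Γ) := by
  have := s.nonempty_outcome Γ
  rw [gameLagrangian_eq]
  exact entropy_add_le_log_sum_exp _ (s.prob Γ).2

lemma gameLagrangian_eq_log_partitionFunction_iff (dev : D → C.Deviation) (Φ : Finset D)
    (θ : Φ → V) (s : C.Strategy) (Γ : 𝒢) :
    gameLagrangian dev Φ θ s Γ = Real.log (partitionFunction dev Φ θ Γ) ↔
      ∀ a, (s.prob Γ).1 a = expWeight dev Φ θ Γ a / partitionFunction dev Φ θ Γ := by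
  have := s.nonempty_outcome Γ
  rw [gameLagrangian_eq]
  exact entropy_add_eq_log_sum_exp_iff _ (s.prob Γ).2

variable {ξ : Measure 𝒢}

lemma integrable_gameLagrangian
    (hC : Integrable (fun Γ => Real.log (Fintype.card (C.Outcome Γ))) ξ)
    {dev : D → C.Deviation} (hdev : ∀ f, Integrable (fun Γ => ⨆ a, ‖(dev f).regret Γ a‖) ξ)
    (Φ : Finset D) (θ : Φ → V) (s : C.Strategy) :
    Integrable (gameLagrangian dev Φ θ s) ξ :=
  (s.integrable_entropy hC).sub <| integrable_finsetSum _ fun f _ =>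
    integrable_sum_mul_inner_regret (hdev f) s (θ f)

lemma integral_gameLagrangian
    (hC : Integrable (fun Γ => Real.log (Fintype.card (C.Outcome Γ))) ξ)
    {dev : D → C.Deviation} (hdev : ∀ f, Integrable (fun Γ => ⨆ a, ‖(dev f).regret Γ a‖) ξ)
    (Φ : Finset D) (θ : Φ → V) (s : C.Strategy) :
    ∫ Γ, gameLagrangian dev Φ θ s Γ ∂ξ =
      condEntropy ξ s - ∑ f : Φ, expectedRegret ξ (dev f) s (θ f) := by
  have h : ∀ f ∈ (Finset.univ : Finset Φ), Integrable
      (fun Γ => ∑ a, (s.prob Γ).1 a * ⟪(dev f).regret Γ a, θ f⟫_ℝ) ξ :=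
    fun f _ => integrable_sum_mul_inner_regret (hdev f) s (θ f)
  simp only [gameLagrangian]
  rw [integral_sub (s.integrable_entropy hC) (integrable_finsetSum _ h), integral_finsetSum _ h]
  rfl

/-! ### The Lagrangian of the maximum entropy program -/

lemma sum_smul_le_maxRegret (dev : D → C.Deviation) (Ψ : Finset D)
    (hΨ : Ψ.Nonempty) (σ : C.Strategy) (w : V) (η : stdSimplex ℝ Ψ) :
    ∑ g : Ψ, η.1 g * expectedRegret ξ (dev g) σ w ≤ maxRegret ξ dev Ψ hΨ σ w :=
  calc ∑ g : Ψ, η.1 g * expectedRegret ξ (dev g) σ w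
      ≤ ∑ g : Ψ, η.1 g * maxRegret ξ dev Ψ hΨ σ w := Finset.sum_le_sum fun g _ =>
        mul_le_mul_of_nonneg_left
          (Finset.le_sup' (fun g => expectedRegret ξ (dev g) σ w) g.2) (η.2.1 g)
    _ = maxRegret ξ dev Ψ hΨ σ w := by rw [← Finset.sum_mul, η.2.2, one_mul]

lemma exists_sum_smul_eq_maxRegret (ξ : Measure 𝒢) (dev : D → C.Deviation) (Ψ : Finset D)
    (hΨ : Ψ.Nonempty) (σ : C.Strategy) (w : V) : ∃ η : stdSimplex ℝ Ψ,
    ∑ g : Ψ, η.1 g * expectedRegret ξ (dev g) σ w = maxRegret ξ dev Ψ hΨ σ w := by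
  classical
  obtain ⟨g, hg, hmax⟩ := Finset.exists_mem_eq_sup' hΨ fun g => expectedRegret ξ (dev g) σ w
  refine ⟨⟨Pi.single ⟨g, hg⟩ 1, single_mem_stdSimplex ℝ _⟩, ?_⟩
  rw [Finset.sum_eq_single ⟨g, hg⟩]
  · simp [maxRegret, hmax]
  · intro b _ hb
    simp [hb]
  · simp

variable [CompleteSpace V]

/-- The decoupling of the predicted strategies from `η`: inner products with `θ` pass through the
integrals. -/
lemma lagrangian_eq
    (hC : Integrable (fun Γ => Real.log (Fintype.card (C.Outcome Γ))) ξ)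
    {dev : D → C.Deviation} (hdev : ∀ f, Integrable (fun Γ => ⨆ a, ‖(dev f).regret Γ a‖) ξ)
    (Φ : Finset D) (Φc : Φ → Finset D) (K : Set V) (σ : C.Strategy)
    (x : C.Strategy × (∀ f : Φ, stdSimplex ℝ (Φc f))) (θ : Φ → V) :
    (iceProgram ξ dev Φ Φc K σ).lagrangian x θ = ∫ Γ, gameLagrangian dev Φ θ x.1 Γ ∂ξ +
      ∑ f : Φ, ∑ g : Φc f, (x.2 f).1 g * expectedRegret ξ (dev g) σ (θ f) := by
  rw [integral_gameLagrangian hC hdev]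
  simp only [ConicProgram.lagrangian, iceProgram, inner_sub_left, sum_inner, inner_smul_left,
    inner_regretFeatures (hdev _), Finset.sum_sub_distrib, RCLike.conj_to_real]
  ring

section

variable (hC : Integrable (fun Γ => Real.log (Fintype.card (C.Outcome Γ))) ξ)
  {dev : D → C.Deviation} (hdev : ∀ f, Integrable (fun Γ => ⨆ a, ‖(dev f).regret Γ a‖) ξ)
  {Φ : Finset D} {Φc : Φ → Finset D} (hΦc : ∀ f, (Φc f).Nonempty) (K : Set V) (σ : C.Strategy)

include hC hdev

lemma lagrangian_le_iceDualObjective (x : C.Strategy × (∀ f : Φ, stdSimplex ℝ (Φc f)))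
    (θ : Φ → V) :
    (iceProgram ξ dev Φ Φc K σ).lagrangian x θ ≤ iceDualObjective ξ dev Φ Φc hΦc σ θ := by
  rw [lagrangian_eq hC hdev, iceDualObjective, add_comm]
  exact add_le_add (Finset.sum_le_sum fun f _ => sum_smul_le_maxRegret _ _ (hΦc f) _ _ _) <|
    integral_mono (integrable_gameLagrangian hC hdev Φ θ x.1)
      (integrable_log_partitionFunction hC σ.nonempty_outcome hdev Φ θ)
      fun Γ => gameLagrangian_le dev Φ θ x.1 Γ

lemma exists_lagrangian_eq_iceDualObjective (θ : Φ → V) :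
    ∃ x, (iceProgram ξ dev Φ Φc K σ).lagrangian x θ = iceDualObjective ξ dev Φ Φc hΦc σ θ := by
  choose η hη using fun f => exists_sum_smul_eq_maxRegret ξ dev (Φc f) (hΦc f) σ (θ f)
  refine ⟨(gibbs σ.nonempty_outcome dev Φ θ, η), ?_⟩
  rw [lagrangian_eq hC hdev, iceDualObjective, add_comm]
  congr 1
  · exact Finset.sum_congr rfl fun f _ => hη f
  · exact integral_congr_ae <| .of_forall fun Γ =>
      (gameLagrangian_eq_log_partitionFunction_iff dev Φ θ _ Γ).2 fun a => rfl

/-- The game part and the `η` part are each bounded separately, so equality of the totals forces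
equality in both; a nonnegative gap of integral zero vanishes almost everywhere. -/
lemma ae_eq_gibbs_of_iceDualObjective_le {x : C.Strategy × (∀ f : Φ, stdSimplex ℝ (Φc f))}
    {θ : Φ → V}
    (h : iceDualObjective ξ dev Φ Φc hΦc σ θ ≤ (iceProgram ξ dev Φ Φc K σ).lagrangian x θ) :
    ∀ᵐ Γ ∂ξ, ∀ a, (x.1.prob Γ).1 a = expWeight dev Φ θ Γ a / partitionFunction dev Φ θ Γ := by
  rw [lagrangian_eq hC hdev, iceDualObjective] at h
  have h1 : ∑ f : Φ, ∑ g : Φc f, (x.2 f).1 g * expectedRegret ξ (dev g) σ (θ f) ≤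
      ∑ f : Φ, maxRegret ξ dev (Φc f) (hΦc f) σ (θ f) :=
    Finset.sum_le_sum fun f _ => sum_smul_le_maxRegret _ _ (hΦc f) _ _ _
  have hL := integrable_gameLagrangian hC hdev Φ θ x.1
  have hZ := integrable_log_partitionFunction hC σ.nonempty_outcome hdev Φ θ
  have h2 := integral_mono hL hZ fun Γ => gameLagrangian_le dev Φ θ x.1 Γ
  have h3 : gameLagrangian dev Φ θ x.1 =ᵐ[ξ] fun Γ => Real.log (partitionFunction dev Φ θ Γ) :=
    (integral_eq_iff_of_ae_le hL hZ (.of_forall fun Γ => gameLagrangian_le dev Φ θ x.1 Γ)).1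
      (le_antisymm h2 (by linarith))
  filter_upwards [h3] with Γ hΓ
  exact (gameLagrangian_eq_log_partitionFunction_iff dev Φ θ x.1 Γ).1 hΓ

lemma dualObjective_eq (θ : Φ → V) :
    (iceProgram ξ dev Φ Φc K σ).dualObjective θ =
      ((iceDualObjective ξ dev Φ Φc hΦc σ θ : ℝ) : EReal) := by
  refine le_antisymm (iSup_le fun x => EReal.coe_le_coe_iff.2
    (lagrangian_le_iceDualObjective hC hdev hΦc K σ x θ)) ?_
  obtain ⟨x, hx⟩ := exists_lagrangian_eq_iceDualObjective hC hdev hΦc K σ θ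
  rw [← hx]
  exact le_iSup (fun x => ((iceProgram ξ dev Φ Φc K σ).lagrangian x θ : EReal)) x

/-- At the combined multiplier the objective equals the Lagrangian at some `x`, which is affine in
the multiplier and bounded by the objective at both endpoints. -/
lemma convexOn_iceDualObjective :
    ConvexOn ℝ {θ : Φ → V | ∀ f, θ f ∈ bidualCone K} (iceDualObjective ξ dev Φ Φc hΦc σ) := by
  refine ⟨fun θ hθ θ' hθ' a b ha hb _ f =>
    add_mem ((bidualCone K).smul_mem (hθ f) ha) ((bidualCone K).smul_mem (hθ' f) hb), ?_⟩
  intro θ _ θ' _ a b ha hb hab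
  obtain ⟨x, hx⟩ := exists_lagrangian_eq_iceDualObjective hC hdev hΦc K σ (a • θ + b • θ')
  have h1 := mul_le_mul_of_nonneg_left
    (lagrangian_le_iceDualObjective hC hdev hΦc K σ x θ) ha
  have h2 := mul_le_mul_of_nonneg_left
    (lagrangian_le_iceDualObjective hC hdev hΦc K σ x θ') hb
  rw [← hx]
  refine le_trans (le_of_eq ?_) (add_le_add h1 h2)
  simp only [ConicProgram.lagrangian, Pi.add_apply, Pi.smul_apply, inner_add_right,
    inner_smul_right, Finset.sum_add_distrib, ← Finset.mul_sum]
  linear_combination -(iceProgram ξ dev Φ Φc K σ).objective x * hab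

/-! ### Primal attainment through strong concavity -/

variable [IsFiniteMeasure ξ]

lemma exists_convexComb (x y : C.Strategy × (∀ f : Φ, stdSimplex ℝ (Φc f))) {a b : ℝ}
    (ha : 0 ≤ a) (hb : 0 ≤ b) (hab : a + b = 1) : ∃ z,
      a * (iceProgram ξ dev Φ Φc K σ).objective x + b * (iceProgram ξ dev Φ Φc K σ).objective y +
        a * b / 2 * ∫ Γ, x.1.sqDist y.1 Γ ∂ξ ≤ (iceProgram ξ dev Φ Φc K σ).objective z ∧
      ∀ f, (iceProgram ξ dev Φ Φc K σ).constraint f z =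
        a • (iceProgram ξ dev Φ Φc K σ).constraint f x +
          b • (iceProgram ξ dev Φ Φc K σ).constraint f y := by
  refine ⟨(x.1.convexComb y.1 ha hb hab, fun f => ⟨a • (x.2 f).1 + b • (y.2 f).1,
    convex_stdSimplex ℝ _ (x.2 f).2 (y.2 f).2 ha hb hab⟩),
    condEntropy_convexComb_ge hC x.1 y.1 ha hb hab, fun f => ?_⟩
  simp only [iceProgram, regretFeatures_convexComb (hdev f), Pi.add_apply, Pi.smul_apply,
    smul_eq_mul, add_smul, mul_smul, Finset.sum_add_distrib, smul_sub, Finset.smul_sum]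
  abel

/-- The infimum of the dual is attained by the objective at a feasible point of the primal. -/
lemma exists_feasible_of_dual_infimum {v : ℝ}
    (hv : ∀ θ : Φ → V, (iceProgram ξ dev Φ Φc K σ).DualFeasible θ →
      v ≤ iceDualObjective ξ dev Φ Φc hΦc σ θ)
    (hv' : ∀ ε > 0, ∃ θ : Φ → V, (iceProgram ξ dev Φ Φc K σ).DualFeasible θ ∧
      iceDualObjective ξ dev Φ Φc hΦc σ θ ≤ v + ε) :
    ∃ x, (iceProgram ξ dev Φ Φc K σ).Feasible x ∧
      v ≤ (iceProgram ξ dev Φ Φc K σ).objective x := by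
  have hle := lagrangian_le_iceDualObjective hC hdev hΦc K σ
  set P := iceProgram ξ dev Φ Φc K σ with hP
  have hX : Nonempty (C.Strategy × (∀ f : Φ, stdSimplex ℝ (Φc f))) :=
    (exists_lagrangian_eq_iceDualObjective hC hdev hΦc K σ 0).nonempty
  obtain ⟨x, u, t, hu, ht, hu0, htv⟩ := P.exists_asymptotically_feasible
    (fun x y a b ha hb hab => by
      obtain ⟨z, hz, hz'⟩ := exists_convexComb hC hdev K σ x y ha hb hab
      refine ⟨z, le_trans (le_add_of_nonneg_right (mul_nonneg (by positivity)
        (integral_nonneg (x.1.sqDist_nonneg y.1)))) hz, hz'⟩)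
    -- The zero multiplier supplies the finite upper bound required of some dual feasible point.
    (θ₀ := 0) (fun i => zero_mem _) (fun x => hle x 0) (v := v) (fun θ hθ m hm => by
      obtain ⟨x, hx⟩ := exists_lagrangian_eq_iceDualObjective hC hdev hΦc K σ θ
      exact (hv θ hθ).trans (hx ▸ hm x))
  obtain ⟨η, ψ, hψ, hη⟩ := CompactSpace.tendsto_subseq fun n => (x n).2
  have hcauchy : ∀ ε > 0, ∃ N, ∀ m ≥ N, ∀ n ≥ N,
      ∫ Γ, (x (ψ m)).1.sqDist (x (ψ n)).1 Γ ∂ξ ≤ ε := by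
    intro ε hε
    -- The midpoint gains `1/8` of the squared distance. The available slack is `ε/16` from `θ`,
    -- `ε/32` from the perturbations and `ε/32` from the objective values, in total `ε/8`.
    obtain ⟨θ, hθ, hθv⟩ := hv' (ε / 16) (by positivity)
    have hg : Filter.Tendsto (fun n => ∑ i, ⟪u (ψ n) i, θ i⟫_ℝ) Filter.atTop (nhds 0) := by
      have h := tendsto_finsetSum (Finset.univ : Finset Φ) fun i _ =>
        (((tendsto_pi_nhds.1 hu0 i).comp hψ.tendsto_atTop).inner (𝕜 := ℝ)
          (tendsto_const_nhds (x := θ i)))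
      simpa using h
    have hev := (hg.eventually_lt_const (show 0 < ε / 32 by positivity)).and
      ((htv.comp hψ.tendsto_atTop).eventually_const_lt (show v - ε / 32 < v by linarith))
    obtain ⟨N, hN⟩ := Filter.eventually_atTop.1 hev
    refine ⟨N, fun m hm n hn => ?_⟩
    obtain ⟨z, hz, hz'⟩ := exists_convexComb hC hdev K σ (x (ψ m)) (x (ψ n))
      (a := 1 / 2) (b := 1 / 2) (by norm_num) (by norm_num) (by norm_num)
    rw [← hP] at hz hz'
    have h1 := P.objective_le_lagrangian_add (x := z)
      (u := (1 / 2 : ℝ) • u (ψ m) + (1 / 2 : ℝ) • u (ψ n)) (θ := θ) (fun i => by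
        have : ((1 / 2 : ℝ) • u (ψ m) + (1 / 2 : ℝ) • u (ψ n)) i - P.constraint i z =
            (1 / 2 : ℝ) • (u (ψ m) i - P.constraint i (x (ψ m))) +
            (1 / 2 : ℝ) • (u (ψ n) i - P.constraint i (x (ψ n))) := by
          simp only [hz', Pi.add_apply, Pi.smul_apply, smul_sub]
          abel
        rw [this]
        exact add_mem ((P.cone i).smul_mem (hu _ i) (by norm_num))
          ((P.cone i).smul_mem (hu _ i) (by norm_num))) hθ
    simp only [Pi.add_apply, Pi.smul_apply, inner_add_left, inner_smul_left,
      Finset.sum_add_distrib, ← Finset.mul_sum, RCLike.conj_to_real] at h1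
    have h2 := hle z θ
    have h3 := ht (ψ m)
    have h4 := ht (ψ n)
    have h5 := hN m hm
    have h6 := hN n hn
    simp only [Function.comp] at h5 h6
    linarith [h5.1, h5.2, h6.1, h6.2]
  obtain ⟨φ, hφ, s, hs⟩ := exists_subseq_tendsto_ae (s := fun n => (x (ψ n)).1) hcauchy
  have hψφ : Filter.Tendsto (fun n => ψ (φ n)) Filter.atTop Filter.atTop :=
    hψ.tendsto_atTop.comp hφ.tendsto_atTop
  refine ⟨(s, η), fun f => ?_, ?_⟩
  · have hη' : Filter.Tendsto (fun n => ∑ g : Φc f,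
        ((x (ψ (φ n))).2 f).1 g • regretFeatures ξ (dev g) σ) Filter.atTop
        (nhds (∑ g : Φc f, (η f).1 g • regretFeatures ξ (dev g) σ)) := by
      have h1 := (continuous_subtype_val.tendsto _).comp
        (tendsto_pi_nhds.1 (hη.comp hφ.tendsto_atTop) f)
      exact tendsto_finsetSum _ fun g _ => (tendsto_pi_nhds.1 h1 g).smul_const _
    have hc : Filter.Tendsto (fun n => u (ψ (φ n)) f - P.constraint f (x (ψ (φ n))))
        Filter.atTop (nhds (0 - P.constraint f (s, η))) :=
      -- The perturbations vanish in the limit, and closedness of the cone turns asymptotic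
      -- feasibility into feasibility.
      ((tendsto_pi_nhds.1 hu0 f).comp hψφ).sub ((tendsto_regretFeatures (hdev f) hs).sub hη')
    rw [zero_sub] at hc
    exact (P.cone f).isClosed.mem_of_tendsto hc (.of_forall fun n => hu _ f)
  · exact le_of_tendsto_of_tendsto (htv.comp hψφ) (tendsto_condEntropy hC hs)
      (.of_forall fun n => ht _)

end

end GameClass

/-! ### Strong duality and recovery of the primal solution -/

namespace GameClass

universe u v w

variable {𝒢 : Type w} [MeasurableSpace 𝒢] {V : Type v} {C : GameClass.{u} 𝒢 V}
  [NormedAddCommGroup V] [InnerProductSpace ℝ V] [CompleteSpace V] {D : Type*} {ξ : Measure 𝒢}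
  (hC : Integrable (fun Γ => Real.log (Fintype.card (C.Outcome Γ))) ξ)
  {dev : D → C.Deviation} (hdev : ∀ f, Integrable (fun Γ => ⨆ a, ‖(dev f).regret Γ a‖) ξ)
  {Φ : Finset D} {Φc : Φ → Finset D} (hΦc : ∀ f, (Φc f).Nonempty) (K : Set V) (σ : C.Strategy)

include hC hdev

lemma dualValue_eq :
    (iceProgram ξ dev Φ Φc K σ).dualValue = ⨅ (θ : Φ → V) (_ : ∀ f, θ f ∈ bidualCone K),
      ((iceDualObjective ξ dev Φ Φc hΦc σ θ : ℝ) : EReal) := by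
  simp only [ConicProgram.dualValue, dualObjective_eq hC hdev hΦc K σ]
  rfl

variable [IsFiniteMeasure ξ]

include hΦc in
lemma value_eq_dualValue :
    (iceProgram ξ dev Φ Φc K σ).value = (iceProgram ξ dev Φ Φc K σ).dualValue := by
  refine le_antisymm (ConicProgram.value_le_dualValue _) ?_
  rw [dualValue_eq hC hdev hΦc]
  set d : EReal := ⨅ (θ : Φ → V) (_ : ∀ f, θ f ∈ bidualCone K),
    ((iceDualObjective ξ dev Φ Φc hΦc σ θ : ℝ) : EReal) with hd
  have hle : ∀ θ : Φ → V, (∀ f, θ f ∈ bidualCone K) →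
      d ≤ ((iceDualObjective ξ dev Φ Φc hΦc σ θ : ℝ) : EReal) := fun θ hθ => iInf₂_le θ hθ
  clear_value d
  -- The value `⊥` needs only weak duality and covers an infeasible primal; `⊤` is excluded by the
  -- real dual value at `0`.
  induction d with
  | bot => exact bot_le
  | top => exact absurd (hle 0 fun f => zero_mem _) (by simp)
  | coe v =>
    obtain ⟨x, hx, hvx⟩ := exists_feasible_of_dual_infimum hC hdev hΦc K σ (v := v)
      (fun θ hθ => EReal.coe_le_coe_iff.1 (hle θ hθ)) fun ε hε => by
        by_contra! hcon
        have h1 : ((v + ε : ℝ) : EReal) ≤ v := by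
          rw [hd]
          exact le_iInf₂ fun θ hθ => EReal.coe_le_coe_iff.2 (hcon θ hθ).le
        linarith [EReal.coe_le_coe_iff.1 h1]
    exact (EReal.coe_le_coe_iff.2 hvx).trans (le_iSup₂ (f := fun x
      (_ : (iceProgram ξ dev Φ Φc K σ).Feasible x) =>
        ((iceProgram ξ dev Φ Φc K σ).objective x : EReal)) x hx)

lemma gibbs_isOptimal_and_ae_unique {θ : Φ → V} (hθ : ∀ f, θ f ∈ bidualCone K)
    (hmin : ∀ θ' : Φ → V, (∀ f, θ' f ∈ bidualCone K) →
      iceDualObjective ξ dev Φ Φc hΦc σ θ ≤ iceDualObjective ξ dev Φ Φc hΦc σ θ') :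
    (∃ x, (iceProgram ξ dev Φ Φc K σ).IsOptimal x ∧
      ∀ Γ a, (x.1.prob Γ).1 a = expWeight dev Φ θ Γ a / partitionFunction dev Φ θ Γ) ∧
    ∀ x, (iceProgram ξ dev Φ Φc K σ).IsOptimal x →
      ∀ᵐ Γ ∂ξ, ∀ a, (x.1.prob Γ).1 a = expWeight dev Φ θ Γ a / partitionFunction dev Φ θ Γ := by
  have hfeas : ∀ x, (iceProgram ξ dev Φ Φc K σ).Feasible x →
      (iceProgram ξ dev Φ Φc K σ).objective x ≤ (iceProgram ξ dev Φ Φc K σ).lagrangian x θ :=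
    fun x hx => by
      simpa using (iceProgram ξ dev Φ Φc K σ).objective_le_lagrangian_add (u := 0)
        (fun i => by simpa using hx i) hθ
  have hle := lagrangian_le_iceDualObjective hC hdev hΦc K σ
  obtain ⟨⟨s, η⟩, hx, hvx⟩ := exists_feasible_of_dual_infimum hC hdev hΦc K σ
    (v := iceDualObjective ξ dev Φ Φc hΦc σ θ) hmin fun ε hε => ⟨θ, hθ, by linarith⟩
  have hs := ae_eq_gibbs_of_iceDualObjective_le hC hdev hΦc K σ (hvx.trans (hfeas _ hx))
  -- Entropy and regrets ignore null sets of games, so the exact Gibbs strategy inherits feasibility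
  -- and value when paired with the same `η`.
  have hs' : ∀ᵐ Γ ∂ξ, s.prob Γ = (gibbs σ.nonempty_outcome dev Φ θ).prob Γ := by
    filter_upwards [hs] with Γ hΓ
    exact Subtype.ext (funext hΓ)
  have hobj : condEntropy ξ s = condEntropy ξ (gibbs σ.nonempty_outcome dev Φ θ) :=
    integral_congr_ae (hs'.mono fun Γ hΓ => by simp only [hΓ])
  have hreg : ∀ f, regretFeatures ξ (dev f) s =
      regretFeatures ξ (dev f) (gibbs σ.nonempty_outcome dev Φ θ) := fun f =>
    integral_congr_ae (hs'.mono fun Γ hΓ => by simp only [gameRegretFeatures, hΓ])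
  refine ⟨⟨(gibbs σ.nonempty_outcome dev Φ θ, η), ⟨fun f => ?_, fun y hy => ?_⟩,
    fun Γ a => rfl⟩, fun x hopt => ?_⟩
  · have := hx f
    simp only [iceProgram, hreg] at this ⊢
    exact this
  · refine ((hfeas y hy).trans (hle y θ)).trans (hvx.trans_eq hobj)
  -- An optimal point has objective at least the dual value, and feasibility puts its Lagrangian at
  -- or above its objective.
  · exact ae_eq_gibbs_of_iceDualObjective_le hC hdev hΦc K σ
      ((hvx.trans (hopt.2 _ hx)).trans (hfeas x hopt.1))

end GameClass

end

theorem mainTheorem10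
    {V : Type*} [NormedAddCommGroup V] [InnerProductSpace ℝ V] [CompleteSpace V]
    {𝒢 : Type*} [MeasurableSpace 𝒢] (C : GameClass 𝒢 V)
    (ξ : Measure 𝒢) [IsProbabilityMeasure ξ]
    (hC : Integrable (fun Γ => Real.log (Fintype.card (C.Outcome Γ))) ξ)
    {D : Type*} (dev : D → C.Deviation)
    (hdev : ∀ f, Integrable (fun Γ => ⨆ a, ‖(dev f).regret Γ a‖) ξ)
    (Φ : Finset D) (Φc : Φ → Finset D) (hΦc : ∀ f, (Φc f).Nonempty)
    (K : Set V) (σ : C.Strategy) :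
    -- the expectations in the primal and in the dual objective exist
    (∀ s : C.Strategy, Integrable (fun Γ => (C.game Γ).entropy (s.prob Γ)) ξ) ∧
    (∀ (f : D) (s : C.Strategy), Integrable (GameClass.gameRegretFeatures (dev f) s) ξ) ∧
    (∀ (f : D) (s : C.Strategy) (w : V), Integrable (fun Γ => ∑ a, (s.prob Γ).1 a * ⟪(dev f).regret Γ a, w⟫_ℝ) ξ) ∧
    (∀ θ : Φ → V,
      Integrable (fun Γ => Real.log (GameClass.partitionFunction dev Φ θ Γ)) ξ) ∧
    -- the Lagrange dual of the primal program
    (∀ θ : Φ → V, (GameClass.iceProgram ξ dev Φ Φc K σ).DualFeasible θ ↔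
      ∀ f, θ f ∈ GameClass.bidualCone K) ∧
    (∀ θ : Φ → V, (GameClass.iceProgram ξ dev Φ Φc K σ).dualObjective θ =
      ((GameClass.iceDualObjective ξ dev Φ Φc hΦc σ θ : ℝ) : EReal)) ∧
    -- the dual is a convex program
    ConvexOn ℝ {θ : Φ → V | ∀ f, θ f ∈ GameClass.bidualCone K}
      (GameClass.iceDualObjective ξ dev Φ Φc hΦc σ) ∧
    -- strong duality
    (GameClass.iceProgram ξ dev Φ Φc K σ).value =
      (GameClass.iceProgram ξ dev Φ Φc K σ).dualValue ∧
    (GameClass.iceProgram ξ dev Φ Φc K σ).dualValue =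
      ⨅ (θ : Φ → V) (_ : ∀ f, θ f ∈ GameClass.bidualCone K),
        ((GameClass.iceDualObjective ξ dev Φ Φc hΦc σ θ : ℝ) : EReal) ∧
    -- recovery of the prediction in each game from optimal dual weights
    (∀ θ : Φ → V, (∀ f, θ f ∈ GameClass.bidualCone K) →
      (∀ θ' : Φ → V, (∀ f, θ' f ∈ GameClass.bidualCone K) →
        GameClass.iceDualObjective ξ dev Φ Φc hΦc σ θ ≤
          GameClass.iceDualObjective ξ dev Φ Φc hΦc σ θ') →
      (∃ x, (GameClass.iceProgram ξ dev Φ Φc K σ).IsOptimal x ∧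
        ∀ Γ a, (x.1.prob Γ).1 a =
          GameClass.expWeight dev Φ θ Γ a / GameClass.partitionFunction dev Φ θ Γ) ∧
      (∀ x, (GameClass.iceProgram ξ dev Φ Φc K σ).IsOptimal x →
        ∀ᵐ Γ ∂ξ, ∀ a, (x.1.prob Γ).1 a =
          GameClass.expWeight dev Φ θ Γ a / GameClass.partitionFunction dev Φ θ Γ)) := by
  refine ⟨fun s => s.integrable_entropy hC,
    fun f s => GameClass.integrable_gameRegretFeatures (hdev f) s,
    fun f s w => GameClass.integrable_sum_mul_inner_regret (hdev f) s w,
    fun θ => GameClass.integrable_log_partitionFunction hC σ.nonempty_outcome hdev Φ θ,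
    fun θ => Iff.rfl,
    fun θ => GameClass.dualObjective_eq hC hdev hΦc K σ θ,
    GameClass.convexOn_iceDualObjective hC hdev hΦc K σ,
    GameClass.value_eq_dualValue hC hdev hΦc K σ,
    GameClass.dualValue_eq hC hdev hΦc K σ,
    fun θ hθ hmin => GameClass.gibbs_isOptimal_and_ae_unique hC hdev hΦc K σ hθ hmin⟩
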